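/- Throughout, $n$ is the dimension, $q,a,b,x_1,\dots,x_n$ are complex numbers with $0<|q|<1$, $(A)_k=\prod_{i=0}^{k-1}(1-Aq^i)$, $(A,B)_k=(A)_k(B)_k$; $\boldsymbol j,\boldsymbol k,\boldsymbol m,\boldsymbol N$ denote $n$-tuples of non-negative integers, $|\boldsymbol k|=k_1+\cdots+k_n$, $q^{\boldsymbol N}=(q^{N_1},\dots,q^{N_n})$, and products $\prod_r$, $\prod_{r,s}$, $\prod_{r<s}$ are over $1\le r,s\le n$. Assume that the parameters are such that no denominator vanishes: $x_r\neq 0$ for all $r$; $x_r/x_s\ne q^{i}$ for all $r\neq s$ and $i\in\mathbb Z$; $ax_rq^i\neq 1$ and $bx_rx_sq^i\ne 1$ for all $r,s$ and all integers $i\ge 0$. Let $K:\mathbb C^n\to\mathbb C$ and let $\beta$ be a complex-valued function of the multi-index $\boldsymbol j$. Consider the identity \begin{align*} K(\boldsymbol y)\sum_{\boldsymbol j\ge 0}& \prod_{r<s}\frac{(1-q^{j_r-j_s}x_r/x_s)(1-bx_rx_sq^{j_r+j_s})}{(1-x_r/x_s)(1-bx_rx_s)} \prod_{r}\frac{1-bx_r^2q^{2j_r}}{1-bx_r^2}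 \prod_{r,s}\frac{(x_r/(x_sy_s))_{j_r}}{(bqx_rx_sy_s)_{j_r}}\\ &\times (y_1\cdots y_n)^{|\boldsymbol j|}\,q^{\sum_r (r-1)j_r}\,\beta(\boldsymbol j)\\ =\sum_{\boldsymbol k\ge 0}& \prod_{r<s}\frac{1-q^{k_r-k_s}x_r/x_s}{1-x_r/x_s} \prod_{r,s}\frac{(x_r/(x_sy_s))_{k_r}}{(qx_r/x_s)_{k_r}} \prod_r\frac{(1-ax_rq^{k_r+|\boldsymbol k|})(ax_r)_{|\boldsymbol k|}}{(1-ax_r)(aqx_ry_r)_{|\boldsymbol k|}}\\ &\times (y_1\cdots y_n)^{|\boldsymbol k|}\,q^{\sum_r (r-1)k_r}\\ \times\sum_{0\le j_r\le k_r}& \prod_{r<s}\frac{(1-q^{j_r-j_s}x_r/x_s)(1-bx_rx_sq^{j_r+j_s})}{(1-x_r/x_s)(1-bx_rx_s)} \prod_r\frac{(1-bx_r^2q^{2j_r})(ax_rq^{|\boldsymbol k|})_{j_r}}{1-bx_r^2}\\ &\times\prod_{r,s}\frac{(q^{-k_s}x_r/x_s,\,bqx_rx_s)_{j_r}}{(bqx_rx_s)_{j_r+j_s}}\;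 (-1)^{|\boldsymbol j|}q^{\sum_r rj_r+\binom{|\boldsymbol j|}{2}}\,\beta(\boldsymbol j)\\ \times\sum_{0\le m_r\le k_r-j_r}& \prod_{r<s}\frac{1-q^{j_r-j_s+m_r-m_s}x_r/x_s}{1-q^{j_r-j_s}x_r/x_s} \prod_{r,s}\frac{(q^{j_r-k_s}x_r/x_s,\,bx_rx_sq^{1+j_r})_{m_r}}{(q^{1+j_r-j_s}x_r/x_s,\,bx_rx_sq^{1+j_r+j_s})_{m_r}}\\ &\times\prod_r\frac{(ax_rq^{j_r+|\boldsymbol k|})_{m_r}}{(aqx_r)_{j_r+m_r}}\; q^{\sum_r rm_r}\,K(q^{\boldsymbol j+\boldsymbol m}). \end{align*} Here $\prod_{r,s}(x_r/(x_sy_s))_{k_r}\,(y_1\cdots y_n)^{|\boldsymbol k|}$ is read as the polynomial $\prod_{r,s}\prod_{i=0}^{k_r-1}(y_s-q^ix_r/x_s)$ in $\boldsymbol y$, so that it is also defined when some $y_s=0$. (i) (Terminating case.) If $\boldsymbol y=q^{\boldsymbol N}$ for some $\boldsymbol N$, then the terms of the series on the left with $\boldsymbol j\not\le\boldsymbol N$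 and the terms of the outer series on the right with $\boldsymbol k\not\le\boldsymbol N$ vanish (so the series terminate), and the identity holds. (ii) (Analytic case.) Let $D=\{\boldsymbol y: |y_r|<\varepsilon_r,\ 1\le r\le n\}$ with all $\varepsilon_r>0$ be an open polydisc such that $ax_ry_rq^{i}\neq1$ and $bx_rx_sy_sq^{i}\neq 1$ for all $\boldsymbol y\in D$, all $r,s$ and all integers $i\geq 1$. Suppose that the series on the left and the outer series on the right converge absolutely for every $\boldsymbol y\in D$ and that both sides of the identity are analytic functions of $\boldsymbol y$ in $D$. Then the identity holds for all $\boldsymbol y\in D$. -/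

import Mathlib

namespace RootSeries

/-- The `q`-rising factorial `(A; q)_k = (1 - A)(1 - A q) ⋯ (1 - A q ^ (k - 1))`. -/
noncomputable def qrf (q A : ℂ) (k : ℕ) : ℂ :=
  ∏ i ∈ Finset.range k, (1 - A * q ^ i)

/-- The sum `|k| = k_1 + ⋯ + k_n` of a multi-index. -/
def msum {n : ℕ} (k : Fin n → ℕ) : ℕ := ∑ r, k r

/-- The point `q ^ N = (q ^ N_1, …, q ^ N_n)`. -/
noncomputable def qpt {n : ℕ} (q : ℂ) (N : Fin n → ℕ) : Fin n → ℂ := fun r => q ^ N r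

/-- The type `A` factor
`∏_{r < s} (1 - q ^ (k_r - k_s) x_r / x_s) / (1 - x_r / x_s)`. -/
noncomputable def vandA {n : ℕ} (q : ℂ) (x : Fin n → ℂ) (k : Fin n → ℕ) : ℂ :=
  ∏ r, ∏ s ∈ Finset.Ioi r,
    (1 - q ^ ((k r : ℤ) - (k s : ℤ)) * (x r / x s)) / (1 - x r / x s)

/-- The additional type `C` factor
`∏_{r < s} (1 - b x_r x_s q ^ (j_r + j_s)) / (1 - b x_r x_s)
  ∏_r (1 - b x_r ^ 2 q ^ (2 j_r)) / (1 - b x_r ^ 2)`. -/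
noncomputable def vandC {n : ℕ} (q b : ℂ) (x : Fin n → ℂ) (j : Fin n → ℕ) : ℂ :=
  (∏ r, ∏ s ∈ Finset.Ioi r,
    (1 - b * x r * x s * q ^ (j r + j s)) / (1 - b * x r * x s)) *
  ∏ r, (1 - b * x r ^ 2 * q ^ (2 * j r)) / (1 - b * x r ^ 2)

/-- The polynomial in `y` that equals
`(∏_{r, s} (x_r / (x_s y_s); q)_{k_r}) (y_1 ⋯ y_n) ^ |k|`
where all `y_s` are nonzero (see `yFactor_eq`), and is its analytic continuation where some
`y_s` vanish. -/
noncomputable def yFactor {n : ℕ} (q : ℂ) (x y : Fin n → ℂ) (k : Fin n → ℕ) : ℂ :=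
  ∏ r, ∏ s, ∏ i ∈ Finset.range (k r), (y s - x r / x s * q ^ i)

theorem yFactor_eq {n : ℕ} (q : ℂ) (x y : Fin n → ℂ) (k : Fin n → ℕ) (hy : ∀ s, y s ≠ 0) :
    yFactor q x y k =
      (∏ r, ∏ s, qrf q (x r / (x s * y s)) (k r)) * (∏ s, y s) ^ msum k := by
  unfold yFactor qrf msum
  rw [← Finset.prod_pow_eq_pow_sum, ← Finset.prod_mul_distrib]
  refine Finset.prod_congr rfl fun r _ => ?_
  rw [← Finset.prod_pow, ← Finset.prod_mul_distrib]
  refine Finset.prod_congr rfl fun s _ => ?_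
  conv_rhs => rw [← Finset.card_range (k r), ← Finset.prod_const, Finset.card_range,
    ← Finset.prod_mul_distrib]
  refine Finset.prod_congr rfl fun i _ => ?_
  have h : x r / (x s * y s) * q ^ i * y s = x r / x s * q ^ i := by
    rw [div_mul_eq_div_div, mul_right_comm, div_mul_cancel₀ _ (hy s)]
  rw [sub_mul, one_mul, h]

/-- The `j`-th term of the `C_n` series on the left-hand side (without the prefactor `K y`). -/
noncomputable def lhsTerm {n : ℕ} (q b : ℂ) (x : Fin n → ℂ) (β : (Fin n → ℕ) → ℂ)
    (y : Fin n → ℂ) (j : Fin n → ℕ) : ℂ :=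
  vandA q x j * vandC q b x j * yFactor q x y j /
    (∏ r, ∏ s, qrf q (b * q * x r * x s * y s) (j r)) *
    q ^ (∑ r : Fin n, (r : ℕ) * j r) * β j

/-- The `m`-th term of the innermost sum on the right-hand side. -/
noncomputable def innerTerm {n : ℕ} (q a b : ℂ) (x : Fin n → ℂ) (K : (Fin n → ℂ) → ℂ)
    (k j m : Fin n → ℕ) : ℂ :=
  (∏ r, ∏ s ∈ Finset.Ioi r,
    (1 - q ^ ((j r : ℤ) - (j s : ℤ) + (m r : ℤ) - (m s : ℤ)) * (x r / x s)) /
      (1 - q ^ ((j r : ℤ) - (j s : ℤ)) * (x r / x s))) *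
  (∏ r, ∏ s,
    (qrf q (q ^ ((j r : ℤ) - (k s : ℤ)) * (x r / x s)) (m r) *
        qrf q (b * x r * x s * q ^ (1 + j r)) (m r)) /
      (qrf q (q ^ (1 + (j r : ℤ) - (j s : ℤ)) * (x r / x s)) (m r) *
        qrf q (b * x r * x s * q ^ (1 + j r + j s)) (m r))) *
  (∏ r, qrf q (a * x r * q ^ (j r + msum k)) (m r) / qrf q (a * q * x r) (j r + m r)) *
  q ^ (∑ r : Fin n, ((r : ℕ) + 1) * m r) * K (qpt q (j + m))

/-- The `j`-th term of the middle sum on the right-hand side, without the innermost sum. -/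
noncomputable def middleTerm {n : ℕ} (q a b : ℂ) (x : Fin n → ℂ) (β : (Fin n → ℕ) → ℂ)
    (k j : Fin n → ℕ) : ℂ :=
  vandA q x j * vandC q b x j *
  (∏ r, qrf q (a * x r * q ^ msum k) (j r)) *
  (∏ r, ∏ s,
    (qrf q (q ^ (-(k s : ℤ)) * (x r / x s)) (j r) * qrf q (b * q * x r * x s) (j r)) /
      qrf q (b * q * x r * x s) (j r + j s)) *
  (-1) ^ msum j * q ^ ((∑ r : Fin n, ((r : ℕ) + 1) * j r) + (msum j).choose 2) * β j

/-- The factor of the `k`-th term of the outer `A_n` series that precedes the two inner sums. -/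
noncomputable def outerTerm {n : ℕ} (q a : ℂ) (x y : Fin n → ℂ) (k : Fin n → ℕ) : ℂ :=
  vandA q x k * yFactor q x y k / (∏ r, ∏ s, qrf q (q * (x r / x s)) (k r)) *
  (∏ r, ((1 - a * x r * q ^ (k r + msum k)) * qrf q (a * x r) (msum k)) /
    ((1 - a * x r) * qrf q (a * q * x r * y r) (msum k))) *
  q ^ (∑ r : Fin n, (r : ℕ) * k r)

/-- The `k`-th term of the outer series on the right-hand side. In the inner sums, `j` and `m`
range over the multi-indices with `0 ≤ j_r ≤ k_r` and `0 ≤ m_r ≤ k_r - j_r` for all `r`. -/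
noncomputable def rhsTerm {n : ℕ} (q a b : ℂ) (x : Fin n → ℂ) (K : (Fin n → ℂ) → ℂ)
    (β : (Fin n → ℕ) → ℂ) (y : Fin n → ℂ) (k : Fin n → ℕ) : ℂ :=
  outerTerm q a x y k *
    ∑ j ∈ Finset.Iic k, middleTerm q a b x β k j *
      ∑ m ∈ Finset.Iic (k - j), innerTerm q a b x K k j m

/-- The open polydisc with radii `ε_r` around the origin. -/
def polydisc {n : ℕ} (ε : Fin n → ℝ) : Set (Fin n → ℂ) := {y | ∀ r, ‖y r‖ < ε r}

end RootSeries

/-!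
For fixed `q`, `a`, `x` the coefficients `outerTerm q a x (q ^ N) k` form a lower triangular matrix
`A` in the multi-indices `N`, `k`. Its inverse is the explicit matrix `inverseTerm q a x k M`. Hence
every function `F` satisfies
`F (q ^ N) = ∑ k ≤ N, outerTerm (q ^ N) k * ∑ M ≤ k, inverseTerm k M * F (q ^ M)`
(`sum_outerTerm_mul_sum_inverseTerm`). The terminating identity is the case
`F y = K y * ∑ j, lhsTerm y j`: at `y = q ^ M` the series stops at `j ≤ M`, and the product
`inverseTerm k (j + m) * lhsTerm (q ^ (j + m)) j` factors, up to the values of `K`, as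
`middleTerm k j * innerTerm k j m` (`middleTerm_mul_innerTerm`).

It suffices to invert from one side on each finite order ideal `M ≤ N`, that is, to show
`∑ M, inverseTerm k M * outerTerm (q ^ M) l = δ_{k l}`. By the same factorization, with `b = 0`,
the off-diagonal entries are multiples of the sum
`∑ m ≤ k, vandA X m * ∏_{r, s} (…)_{m_r} / (…)_{m_r} * q ^ ∑ r m_r * ∏_r P (X_r q ^ m_r)`, now with
`k - l` in place of `k`, for a polynomial `P` of degree less than `|k|`. In this sum `vandA` is
up to a power of `q` and a constant the Vandermonde determinant of the points `X_r q ^ m_r`, and the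
remaining factors become, again up to a constant, the Lagrange weights `w` of these points with
respect to the set `Z` of all nodes `X_r q ^ i`, `0 ≤ i ≤ k_r`. So the sum is a multiple of
`det (∑_i w(z) P(z) z ^ s)_{r, s}`, where `z = X_r q ^ i`. The rows of this matrix
add up to `∑_{z ∈ Z} w(z) P(z) z ^ s`, which is zero since `deg P + s < |Z| - 1`
for `0 ≤ s < n`, and therefore the determinant vanishes (`sum_vandA_mul_eval_eq_zero`).

The analytic case follows because the points `q ^ N` accumulate at the origin in every coordinate
direction (`eqOn_polydisc_of_eq_qpt`).
-/

namespace RootSeries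

/-! ### The `q`-rising factorial -/

theorem qrf_add (q A : ℂ) (m n : ℕ) :
    qrf q A (m + n) = qrf q A m * qrf q (A * q ^ m) n := by
  simp only [qrf, Finset.prod_range_add, pow_add, mul_assoc]

theorem qrf_succ (q A : ℂ) (m : ℕ) : qrf q A (m + 1) = qrf q A m * (1 - A * q ^ m) :=
  Finset.prod_range_succ _ _

theorem qrf_succ' (q A : ℂ) (m : ℕ) : qrf q A (m + 1) = (1 - A) * qrf q (A * q) m := by
  rw [add_comm, qrf_add]
  simp [qrf]

theorem qrf_zpow_add {q : ℂ} (hq : q ≠ 0) (A : ℂ) (e : ℤ) (m n : ℕ) :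
    qrf q (q ^ e * A) (m + n) = qrf q (q ^ e * A) m * qrf q (q ^ (e + m) * A) n := by
  rw [qrf_add, zpow_add₀ hq, zpow_natCast, mul_right_comm]

theorem qrf_ne_zero {q A : ℂ} {k : ℕ} (h : ∀ i : ℕ, 1 - A * q ^ i ≠ 0) : qrf q A k ≠ 0 :=
  Finset.prod_ne_zero_iff.2 fun i _ => h i

/-- Reversal of the order of the factors of a `q`-rising factorial. -/
theorem prod_sub_mul_pow {q Y : ℂ} (hq : q ≠ 0) (hY : Y ≠ 0) (e v : ℕ) :
    ∏ i ∈ Finset.range v, (q ^ e - Y * q ^ i) =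
      (-Y) ^ v * q ^ v.choose 2 * qrf q (q ^ (1 + (e : ℤ) - v) * Y⁻¹) v := by
  have h : ∀ i ∈ Finset.range v, q ^ e - Y * q ^ i =
      (-Y) * q ^ i * (1 - q ^ ((e : ℤ) - i) * Y⁻¹) := by
    intro i _
    rw [zpow_sub₀ hq, zpow_natCast, zpow_natCast]
    field_simp
    ring
  rw [Finset.prod_congr rfl h, Finset.prod_mul_distrib, Finset.prod_mul_distrib,
    Finset.prod_const, Finset.card_range, Finset.prod_pow_eq_pow_sum, Finset.sum_range_id,
    Nat.choose_two_right, qrf, ← Finset.prod_range_reflect]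
  congr 1
  refine Finset.prod_congr rfl fun i hi => ?_
  have hi' : i < v := Finset.mem_range.1 hi
  have h1 : ((v - 1 - i : ℕ) : ℤ) = v - 1 - i := by omega
  rw [h1, mul_right_comm, ← zpow_natCast q i, ← zpow_add₀ hq]
  congr 3
  ring

theorem two_mul_choose_two_add (k : ℕ) : 2 * k.choose 2 + k = k ^ 2 := by
  induction k with
  | zero => rfl
  | succ k ih =>
    have : (k + 1).choose 2 = k + k.choose 2 := by simp [Nat.choose_succ_succ']
    rw [this]
    nlinarith

theorem choose_two_add (u v : ℕ) : (u + v).choose 2 = u.choose 2 + v.choose 2 + u * v := by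
  have h1 := two_mul_choose_two_add u
  have h2 := two_mul_choose_two_add v
  have h3 := two_mul_choose_two_add (u + v)
  nlinarith

/-- The case `u = v + d` of `pair_identity`. -/
theorem pair_identity_add {q X : ℂ} (hq : q ≠ 0) (hX : X ≠ 0) (v d m m' : ℕ) :
    (1 - q ^ (((v + d : ℕ) : ℤ) - v) * X) *
        ((∏ i ∈ Finset.range (v + d), (q ^ (v + m') - X * q ^ i)) *
          ∏ i ∈ Finset.range v, (q ^ (v + d + m) - X⁻¹ * q ^ i)) * q ^ v *
        (qrf q (q ^ (1 + ((v + d : ℕ) : ℤ) - v) * X) m *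
          qrf q (q ^ (1 + (v : ℤ) - (v + d : ℕ)) * X⁻¹) m') =
      q ^ ((v + d) * v) * (qrf q (q * X) (v + d + m) * qrf q (q * X⁻¹) (v + m')) * (1 - X) := by
  rw [prod_sub_mul_pow hq hX, prod_sub_mul_pow hq (inv_ne_zero hX), inv_inv]
  have e1 : (1 + ((v + m' : ℕ) : ℤ) - (v + d : ℕ)) = (1 - (d : ℤ)) + m' := by push_cast; ring
  have e2 : (1 + ((v + d + m : ℕ) : ℤ) - v) = (1 + (d : ℤ)) + m := by push_cast; ring
  have e3 : (1 + ((v + d : ℕ) : ℤ) - v) = 1 + (d : ℤ) := by push_cast; ring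
  have e4 : (1 + (v : ℤ) - (v + d : ℕ)) = 1 - (d : ℤ) := by push_cast; ring
  have e5 : (((v + d : ℕ) : ℤ) - v) = (d : ℤ) := by push_cast; ring
  rw [e1, e2, e3, e4, e5]
  have h1 := qrf_zpow_add hq X⁻¹ (1 - (d : ℤ)) m' (v + d)
  have h2 := qrf_zpow_add hq X⁻¹ (1 - (d : ℤ)) d (v + m')
  have h3 := qrf_zpow_add hq X (1 + (d : ℤ)) m v
  have h4 := qrf_add q (q * X) d (m + v)
  have h5 : (1 - X) * qrf q (q * X) d = qrf q X d * (1 - q ^ (d : ℤ) * X) := by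
    rw [mul_comm q X, ← qrf_succ', qrf_succ, zpow_natCast, mul_comm X]
  have h6 : qrf q X d = (-X) ^ d * q ^ d.choose 2 * qrf q (q ^ (1 - (d : ℤ)) * X⁻¹) d := by
    have := prod_sub_mul_pow hq hX 0 d
    simpa [qrf] using this
  rw [sub_add_cancel, zpow_one] at h2
  have e6 : q * X * q ^ d = q ^ (1 + (d : ℤ)) * X := by
    rw [zpow_add₀ hq, zpow_natCast, zpow_one]; ring
  rw [e6] at h4
  have e7 : m' + (v + d) = d + (v + m') := by ring
  have e8 : v + d + m = d + (m + v) := by ring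
  rw [e7] at h1
  rw [e8, h4, h3]
  have hc : (v + d).choose 2 + v.choose 2 + v = (v + d) * v + d.choose 2 := by
    have := choose_two_add v d
    have := two_mul_choose_two_add v
    nlinarith
  have hs : (-X) ^ (v + d) * (-X⁻¹) ^ v = (-X) ^ d := by
    rw [pow_add, mul_right_comm, ← mul_pow]; simp [hX]
  have hs' : (-X) ^ (v + d) * (-X⁻¹) ^ v * (q ^ (v + d).choose 2 * q ^ v.choose 2 * q ^ v) =
      q ^ ((v + d) * v) * ((-X) ^ d * q ^ d.choose 2) := by
    rw [hs, ← pow_add, ← pow_add, hc, pow_add]; ring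
  set P := qrf q (q ^ (1 - (d : ℤ)) * X⁻¹) m'
  set Q := qrf q (q ^ (1 - (d : ℤ) + m') * X⁻¹) (v + d)
  set R := qrf q (q ^ (1 - (d : ℤ)) * X⁻¹) d
  set S := qrf q (q * X⁻¹) (v + m')
  set T := qrf q (q ^ (1 + (d : ℤ)) * X) m
  set U := qrf q (q ^ (1 + (d : ℤ) + m) * X) v
  set Z := q ^ (d : ℤ)
  -- two ways to split a factorial of length `m' + (v + d) = d + (v + m')`
  have h7 : P * Q = R * S := by rw [← h1, ← h2]
  calc _ = (1 - Z * X) * ((-X) ^ (v + d) * (-X⁻¹) ^ v *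
            (q ^ (v + d).choose 2 * q ^ v.choose 2 * q ^ v)) * (P * Q) * T * U := by ring
    _ = q ^ ((v + d) * v) * (((-X) ^ d * q ^ d.choose 2 * R) * (1 - Z * X)) * (T * U) * S := by
      rw [hs', h7]; ring
    _ = _ := by rw [← h6, ← h5]; ring

/-- The contribution of a pair `r < s` to `vandA_yFactor_mul`, with `X = x_r / x_s`, `u = j_r`,
`v = j_s`, `m = m_r` and `m' = m_s`. The factors `q ^ v` and `q ^ (u * v)` make up the powers of `q`
there. -/
theorem pair_identity {q X : ℂ} (hq : q ≠ 0) (hX : X ≠ 0) (u v m m' : ℕ) :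
    (1 - q ^ ((u : ℤ) - v) * X) *
        ((∏ i ∈ Finset.range u, (q ^ (v + m') - X * q ^ i)) *
          ∏ i ∈ Finset.range v, (q ^ (u + m) - X⁻¹ * q ^ i)) * q ^ v *
        (qrf q (q ^ (1 + (u : ℤ) - v) * X) m * qrf q (q ^ (1 + (v : ℤ) - u) * X⁻¹) m') =
      q ^ (u * v) * (qrf q (q * X) (u + m) * qrf q (q * X⁻¹) (v + m')) * (1 - X) := by
  rcases le_total v u with h | h
  · obtain ⟨d, rfl⟩ := Nat.exists_eq_add_of_le h
    exact pair_identity_add hq hX v d m m'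
  · -- exchanging the two indices and inverting `X` multiplies both sides by `-X⁻¹`
    obtain ⟨d, rfl⟩ := Nat.exists_eq_add_of_le h
    have key := pair_identity_add hq (inv_ne_zero hX) u d m' m
    rw [inv_inv] at key
    have h1 : (1 - q ^ (((u + d : ℕ) : ℤ) - u) * X⁻¹) * q ^ u =
        -X⁻¹ * ((1 - q ^ ((u : ℤ) - (u + d : ℕ)) * X) * q ^ (u + d)) := by
      rw [zpow_sub₀ hq, zpow_sub₀ hq]
      simp only [zpow_natCast]
      field_simp
      ring
    have h2 : (1 - X⁻¹) = -X⁻¹ * (1 - X) := by field_simp; ring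
    have h3 : -X⁻¹ ≠ 0 := by simpa using hX
    apply mul_left_cancel₀ h3
    rw [h2] at key
    linear_combination key - (∏ i ∈ Finset.range (u + d), (q ^ (u + m) - X⁻¹ * q ^ i)) *
          (∏ i ∈ Finset.range u, (q ^ (u + d + m') - X * q ^ i)) *
        (qrf q (q ^ (1 + ((u + d : ℕ) : ℤ) - u) * X⁻¹) m' *
          qrf q (q ^ (1 + (u : ℤ) - (u + d : ℕ)) * X) m) * h1

/-- The contribution of the diagonal `r = s` to `vandA_yFactor_mul`. -/
theorem self_identity {q : ℂ} (hq : q ≠ 0) (u m : ℕ) :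
    (∏ i ∈ Finset.range u, (q ^ (u + m) - q ^ i)) * qrf q q m =
      (-1) ^ u * q ^ u.choose 2 * qrf q q (u + m) := by
  have h := prod_sub_mul_pow hq one_ne_zero (u + m) u
  have e : (1 + ((u + m : ℕ) : ℤ) - u) = 1 + (m : ℤ) := by push_cast; ring
  have h2 := qrf_zpow_add hq 1 1 m u
  simp only [one_mul, inv_one, mul_one, e, zpow_one] at h h2
  rw [h, add_comm u m, h2]
  ring

/-! ### Products over pairs of indices -/

@[to_additive]
theorem prod_prod_eq_diag_mul_Ioi {M : Type*} [CommMonoid M] {n : ℕ} (f : Fin n → Fin n → M) :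
    ∏ r, ∏ s, f r s = (∏ r, f r r) * ∏ r, ∏ s ∈ Finset.Ioi r, (f r s * f s r) := by
  have h := Finset.prod_prod_Ioi_mul_eq_prod_prod_off_diag fun r s => f s r
  rw [h, ← Finset.prod_mul_distrib]
  refine Finset.prod_congr rfl fun r _ => ?_
  rw [← Finset.prod_mul_prod_compl {r} (f r), Finset.prod_singleton]

theorem sum_sum_Ioi_right {n : ℕ} (f : Fin n → ℕ) :
    ∑ r, ∑ s ∈ Finset.Ioi r, f s = ∑ s : Fin n, (s : ℕ) * f s := by
  rw [Finset.sum_comm' (t' := Finset.univ) (s' := fun s => Finset.Iio s) (by simp)]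
  simp

theorem choose_two_msum {n : ℕ} (j : Fin n → ℕ) :
    (msum j).choose 2 = ∑ r, (j r).choose 2 + ∑ r, ∑ s ∈ Finset.Ioi r, j r * j s := by
  have h1 := two_mul_choose_two_add (msum j)
  have h2 : msum j ^ 2 = ∑ r, ∑ s, j r * j s := by
    rw [sq, msum, Finset.sum_mul_sum]
  have h3 : ∑ r, j r * j r = 2 * ∑ r, (j r).choose 2 + msum j := by
    rw [msum, Finset.mul_sum, ← Finset.sum_add_distrib]
    exact Finset.sum_congr rfl fun r _ => by rw [two_mul_choose_two_add, sq]
  have h4 : ∑ r, ∑ s ∈ Finset.Ioi r, (j r * j s + j s * j r) =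
      2 * ∑ r, ∑ s ∈ Finset.Ioi r, j r * j s := by
    simp only [Finset.mul_sum]
    exact Finset.sum_congr rfl fun r _ => Finset.sum_congr rfl fun s _ => by ring
  rw [sum_sum_eq_diag_add_Ioi, h3, h4] at h2
  omega

/-- Simplification of the `y`-dependent factor at `y = q ^ (j + m)`. It turns the product of the
inverse matrix with a term of the left-hand side into a product of a middle and an inner term. -/
theorem vandA_yFactor_mul {n : ℕ} {q : ℂ} {x : Fin n → ℂ} (hq : q ≠ 0) (hx : ∀ r, x r ≠ 0)
    (hxx : ∀ r s, r ≠ s → ∀ i : ℤ, x r / x s ≠ q ^ i) (j m : Fin n → ℕ) :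
    vandA q x j * yFactor q x (qpt q (j + m)) j * q ^ (∑ r : Fin n, (r : ℕ) * j r) *
        ∏ r, ∏ s, qrf q (q ^ (1 + (j r : ℤ) - (j s : ℤ)) * (x r / x s)) (m r) =
      (-1) ^ msum j * q ^ (msum j).choose 2 *
        ∏ r, ∏ s, qrf q (q * (x r / x s)) (j r + m r) := by
  rw [choose_two_msum, pow_add, msum, ← sum_sum_Ioi_right, yFactor, vandA,
    prod_prod_eq_diag_mul_Ioi, prod_prod_eq_diag_mul_Ioi
      fun r s => qrf q (q ^ (1 + (j r : ℤ) - (j s : ℤ)) * (x r / x s)) (m r),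
    prod_prod_eq_diag_mul_Ioi fun r s => qrf q (q * (x r / x s)) (j r + m r)]
  simp only [← Finset.prod_pow_eq_pow_sum]
  have hd : (∏ r, ∏ i ∈ Finset.range (j r), (qpt q (j + m) r - x r / x r * q ^ i)) *
      ∏ r, qrf q (q ^ (1 + (j r : ℤ) - (j r : ℤ)) * (x r / x r)) (m r) =
      (∏ r, (-1) ^ j r) * (∏ r, q ^ (j r).choose 2) *
        ∏ r, qrf q (q * (x r / x r)) (j r + m r) := by
    simp only [← Finset.prod_mul_distrib]
    refine Finset.prod_congr rfl fun r _ => ?_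
    simpa [qpt, div_self (hx r)] using self_identity hq (j r) (m r)
  have ho : (∏ r, ∏ s ∈ Finset.Ioi r,
        (1 - q ^ ((j r : ℤ) - (j s : ℤ)) * (x r / x s)) / (1 - x r / x s)) *
      (∏ r, ∏ s ∈ Finset.Ioi r,
        ((∏ i ∈ Finset.range (j r), (qpt q (j + m) s - x r / x s * q ^ i)) *
          ∏ i ∈ Finset.range (j s), (qpt q (j + m) r - x s / x r * q ^ i))) *
      (∏ r, ∏ s ∈ Finset.Ioi r, q ^ j s) *
      (∏ r, ∏ s ∈ Finset.Ioi r,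
        (qrf q (q ^ (1 + (j r : ℤ) - (j s : ℤ)) * (x r / x s)) (m r) *
          qrf q (q ^ (1 + (j s : ℤ) - (j r : ℤ)) * (x s / x r)) (m s))) =
      (∏ r, ∏ s ∈ Finset.Ioi r, q ^ (j r * j s)) *
        ∏ r, ∏ s ∈ Finset.Ioi r,
          (qrf q (q * (x r / x s)) (j r + m r) * qrf q (q * (x s / x r)) (j s + m s)) := by
    simp only [← Finset.prod_mul_distrib]
    refine Finset.prod_congr rfl fun r _ => Finset.prod_congr rfl fun s hs => ?_
    have hrs : r ≠ s := (Finset.mem_Ioi.1 hs).ne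
    have h1 : 1 - x r / x s ≠ 0 := fun h =>
      hxx r s hrs 0 (by rw [zpow_zero]; linear_combination -h)
    have key := pair_identity hq (div_ne_zero (hx r) (hx s)) (j r) (j s) (m r) (m s)
    rw [inv_div] at key
    rw [div_mul_eq_mul_div, div_mul_eq_mul_div, div_mul_eq_mul_div, div_eq_iff h1]
    exact key
  linear_combination hd * ((∏ r, ∏ s ∈ Finset.Ioi r,
        (1 - q ^ ((j r : ℤ) - (j s : ℤ)) * (x r / x s)) / (1 - x r / x s)) *
      (∏ r, ∏ s ∈ Finset.Ioi r,
        ((∏ i ∈ Finset.range (j r), (qpt q (j + m) s - x r / x s * q ^ i)) *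
          ∏ i ∈ Finset.range (j s), (qpt q (j + m) r - x s / x r * q ^ i))) *
      (∏ r, ∏ s ∈ Finset.Ioi r, q ^ j s) *
      (∏ r, ∏ s ∈ Finset.Ioi r,
        (qrf q (q ^ (1 + (j r : ℤ) - (j s : ℤ)) * (x r / x s)) (m r) *
          qrf q (q ^ (1 + (j s : ℤ) - (j r : ℤ)) * (x s / x r)) (m s)))) +
    ho * ((∏ r, (-1) ^ j r) * (∏ r, q ^ (j r).choose 2) *
        ∏ r, qrf q (q * (x r / x r)) (j r + m r))

/-! ### Lagrange weights and a vanishing sum -/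

open Polynomial in
/-- The weighted sum is the coefficient of `X ^ (#s - 1)` in `P`. -/
theorem sum_eval_div_prod_eq_zero {ι : Type*} [DecidableEq ι] {s : Finset ι} {v : ι → ℂ}
    (hv : Set.InjOn v s) {P : ℂ[X]} (hP : P.natDegree + 1 < s.card) :
    ∑ i ∈ s, P.eval (v i) / ∏ j ∈ s.erase i, (v i - v j) = 0 := by
  rw [← Lagrange.coeff_eq_sum hv
    (lt_of_le_of_lt degree_le_natDegree (by exact_mod_cast (by omega)))]
  exact coeff_eq_zero_of_natDegree_lt (by omega)

/-- The product of the differences of `X q ^ i` with the nodes `1, q, …, q ^ k`, compared with its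
value at `i = 0`. -/
theorem prod_range_sub_mul_qrf {q : ℂ} (hq : q ≠ 0) (X : ℂ) (k i : ℕ) :
    (∏ t ∈ Finset.range (k + 1), (X * q ^ i - q ^ t)) * qrf q (q ^ (-(k : ℤ)) * X) i =
      (∏ t ∈ Finset.range (k + 1), (X - q ^ t)) * qrf q (q * X) i := by
  induction i with
  | zero => simp [qrf]
  | succ i ih =>
    have h1 : ∏ t ∈ Finset.range (k + 1), (X * q ^ (i + 1) - q ^ t) =
        q ^ k * (∏ t ∈ Finset.range k, (X * q ^ i - q ^ t)) * (X * q ^ (i + 1) - 1) := by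
      rw [Finset.prod_range_succ', pow_zero]
      congr 1
      rw [← Finset.card_range k, ← Finset.prod_const, Finset.card_range,
        ← Finset.prod_mul_distrib]
      exact Finset.prod_congr rfl fun t _ => by ring
    have h2 : q ^ k * (1 - q ^ (-(k : ℤ)) * X * q ^ i) = q ^ k - X * q ^ i := by
      rw [zpow_neg, zpow_natCast]
      field_simp
    rw [h1, qrf_succ, qrf_succ]
    rw [Finset.prod_range_succ] at ih
    linear_combination (X * q ^ (i + 1) - 1) * (∏ t ∈ Finset.range k, (X * q ^ i - q ^ t)) *
      qrf q (q ^ (-(k : ℤ)) * X) i * h2 + (1 - q * X * q ^ i) * ih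

/-- The case `X = 1` of `prod_range_sub_mul_qrf` after cancelling the vanishing factor. -/
theorem prod_erase_sub_mul_qrf {q : ℂ} (hq : q ≠ 0) {k i : ℕ} (hi : i ≤ k) :
    (∏ t ∈ (Finset.range (k + 1)).erase i, (q ^ i - q ^ t)) *
        (q ^ i * qrf q (q ^ (-(k : ℤ))) i) =
      (∏ t ∈ (Finset.range (k + 1)).erase 0, (1 - q ^ t)) * qrf q q i := by
  -- for `X ≠ 1` the common factor `X - 1` can be cancelled; then `X` tends to `1`
  have h : (fun X : ℂ => (∏ t ∈ (Finset.range (k + 1)).erase i, (X * q ^ i - q ^ t)) *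
        (q ^ i * qrf q (q ^ (-(k : ℤ)) * X) i)) =
      fun X => (∏ t ∈ (Finset.range (k + 1)).erase 0, (X - q ^ t)) * qrf q (q * X) i := by
    refine Continuous.ext_on (dense_compl_singleton (1 : ℂ)) ?_ ?_ ?_
    · unfold qrf; fun_prop
    · unfold qrf; fun_prop
    · intro X hX
      have hX' : X - 1 ≠ 0 := sub_ne_zero.2 hX
      apply mul_left_cancel₀ hX'
      have key := prod_range_sub_mul_qrf hq X k i
      rw [← Finset.mul_prod_erase (Finset.range (k + 1)) (fun t => X * q ^ i - q ^ t)
          (Finset.mem_range.2 (Nat.lt_succ_of_le hi)),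
        ← Finset.mul_prod_erase (Finset.range (k + 1)) (fun t => X - q ^ t)
          (Finset.mem_range.2 (Nat.succ_pos k)), pow_zero] at key
      linear_combination key
  simpa using congrFun h 1

/-- The index set of the nodes `X_r q ^ i`, `0 ≤ i ≤ k_r`. -/
def nodes {n : ℕ} (k : Fin n → ℕ) : Finset (Σ _ : Fin n, ℕ) :=
  Finset.univ.sigma fun r => Finset.range (k r + 1)

/-- The product of the differences of the node `X_r q ^ i` with all other nodes; its inverse is
the Lagrange weight of the node. -/
noncomputable def nodeProd {n : ℕ} (q : ℂ) (X : Fin n → ℂ) (k : Fin n → ℕ) (r : Fin n) (i : ℕ) :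
    ℂ :=
  ∏ z ∈ (nodes k).erase ⟨r, i⟩, (X r * q ^ i - X z.1 * q ^ z.2)

theorem injective_node {n : ℕ} {q : ℂ} {X : Fin n → ℂ} (hq0 : q ≠ 0) (hq1 : ‖q‖ < 1)
    (hX : ∀ r, X r ≠ 0) (hXX : ∀ r s, r ≠ s → ∀ i : ℤ, X r / X s ≠ q ^ i) :
    Function.Injective fun z : Σ _ : Fin n, ℕ => X z.1 * q ^ z.2 := by
  rintro ⟨r, i⟩ ⟨s, t⟩ h
  simp only at h
  obtain rfl | hrs := eq_or_ne r s
  · have h1 : q ^ i = q ^ t := mul_left_cancel₀ (hX r) h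
    have h2 : ‖q‖ ^ i = ‖q‖ ^ t := by rw [← norm_pow, h1, norm_pow]
    rw [pow_right_injective₀ (norm_pos_iff.2 hq0) hq1.ne h2]
  · refine absurd ?_ (hXX r s hrs ((t : ℤ) - i))
    rw [zpow_sub₀ hq0, zpow_natCast, zpow_natCast, div_eq_div_iff (hX s) (pow_ne_zero _ hq0), h,
      mul_comm]

theorem nodeProd_eq {n : ℕ} (q : ℂ) (X : Fin n → ℂ) (k : Fin n → ℕ) (r : Fin n) (i : ℕ) :
    nodeProd q X k r i =
      (∏ t ∈ (Finset.range (k r + 1)).erase i, (X r * q ^ i - X r * q ^ t)) *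
        ∏ s ∈ {r}ᶜ, ∏ t ∈ Finset.range (k s + 1), (X r * q ^ i - X s * q ^ t) := by
  have h : (nodes k).erase ⟨r, i⟩ = Finset.univ.sigma fun s =>
      if s = r then (Finset.range (k r + 1)).erase i else Finset.range (k s + 1) := by
    ext ⟨s, t⟩
    by_cases hs : s = r
    · subst hs; simp [nodes]
    · simp [nodes, hs]
  rw [nodeProd, h, Finset.prod_sigma, Fintype.prod_eq_mul_prod_compl r, if_pos rfl]
  congr 1
  refine Finset.prod_congr rfl fun s hs => ?_
  rw [if_neg (by simpa using hs)]

/-- The Lagrange weight at `X_r q ^ i` is the weight at `X_r` times the basic hypergeometric factor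
`q ^ i ∏_s (q ^ (-k_s) X_r / X_s)_i / (q X_r / X_s)_i`. -/
theorem nodeProd_mul {n : ℕ} {q : ℂ} {X : Fin n → ℂ} (hq0 : q ≠ 0) (hX : ∀ r, X r ≠ 0)
    {k : Fin n → ℕ} {r : Fin n} {i : ℕ} (hi : i ≤ k r) :
    nodeProd q X k r i * (q ^ i * ∏ s, qrf q (q ^ (-(k s : ℤ)) * (X r / X s)) i) =
      nodeProd q X k r 0 * ∏ s, qrf q (q * (X r / X s)) i := by
  have hd : ∀ e ≤ k r, ∏ t ∈ (Finset.range (k r + 1)).erase e, (X r * q ^ e - X r * q ^ t) =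
      X r ^ k r * ∏ t ∈ (Finset.range (k r + 1)).erase e, (q ^ e - q ^ t) := by
    intro e he
    have hc : ((Finset.range (k r + 1)).erase e).card = k r := by
      rw [Finset.card_erase_of_mem (Finset.mem_range.2 (by omega)), Finset.card_range]; omega
    simp only [← mul_sub, Finset.prod_mul_distrib, Finset.prod_const, hc]
  have ho : (∏ s ∈ {r}ᶜ, ∏ t ∈ Finset.range (k s + 1), (X r * q ^ i - X s * q ^ t)) *
        (∏ s ∈ {r}ᶜ, qrf q (q ^ (-(k s : ℤ)) * (X r / X s)) i) =
      (∏ s ∈ {r}ᶜ, ∏ t ∈ Finset.range (k s + 1), (X r * q ^ 0 - X s * q ^ t)) *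
        ∏ s ∈ {r}ᶜ, qrf q (q * (X r / X s)) i := by
    simp only [← Finset.prod_mul_distrib]
    refine Finset.prod_congr rfl fun s _ => ?_
    have h1 : ∀ e, ∏ t ∈ Finset.range (k s + 1), (X r * q ^ e - X s * q ^ t) =
        X s ^ (k s + 1) * ∏ t ∈ Finset.range (k s + 1), (X r / X s * q ^ e - q ^ t) := by
      intro e
      rw [← Finset.card_range (k s + 1), ← Finset.prod_const, Finset.card_range,
        ← Finset.prod_mul_distrib]
      refine Finset.prod_congr rfl fun t _ => ?_
      rw [mul_sub, ← mul_assoc, mul_div_cancel₀ _ (hX s)]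
    have key := prod_range_sub_mul_qrf hq0 (X r / X s) (k s) i
    rw [h1, h1, pow_zero, mul_one, mul_assoc, key, mul_assoc]
  have hs := prod_erase_sub_mul_qrf hq0 hi
  rw [nodeProd_eq, nodeProd_eq, hd i hi, hd 0 (Nat.zero_le _), Fintype.prod_eq_mul_prod_compl r,
    Fintype.prod_eq_mul_prod_compl r, div_self (hX r), mul_one, mul_one, pow_zero]
  rw [pow_zero] at ho
  linear_combination X r ^ k r * hs *
    ((∏ s ∈ {r}ᶜ, ∏ t ∈ Finset.range (k s + 1), (X r * q ^ i - X s * q ^ t)) *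
        (∏ s ∈ {r}ᶜ, qrf q (q ^ (-(k s : ℤ)) * (X r / X s)) i)) +
    X r ^ k r * (∏ t ∈ (Finset.range (k r + 1)).erase 0, (1 - q ^ t)) * qrf q q i * ho

/-- Up to a power of `q`, `vandA` is the quotient of the Vandermonde determinants at `X_r q ^ m_r`
and `X_r`. -/
theorem vandA_mul_pow {n : ℕ} {q : ℂ} {X : Fin n → ℂ} (hq0 : q ≠ 0) (hX : ∀ r, X r ≠ 0)
    (m : Fin n → ℕ) :
    vandA q X m * q ^ (∑ r : Fin n, (r : ℕ) * m r) =
      (∏ r, ∏ s ∈ Finset.Ioi r, (X s * q ^ m s - X r * q ^ m r)) /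
        ∏ r, ∏ s ∈ Finset.Ioi r, (X s - X r) := by
  rw [← sum_sum_Ioi_right, vandA]
  simp only [← Finset.prod_pow_eq_pow_sum, ← Finset.prod_mul_distrib, ← Finset.prod_div_distrib]
  refine Finset.prod_congr rfl fun r _ => Finset.prod_congr rfl fun s _ => ?_
  have h1 : 1 - X r / X s = (X s - X r) / X s := by field_simp [hX s]
  rw [h1, div_div_eq_mul_div, div_mul_eq_mul_div, zpow_sub₀ hq0, zpow_natCast, zpow_natCast]
  congr 1
  have := hX s
  field_simp

open Polynomial in
/-- The determinant of the matrix with rows `∑ i, P(z) z ^ s / nodeProd`, where `z` runs through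
the nodes `X_r q ^ i`, expands into the sum over `m` below. It vanishes because the sum of its
rows does, by Lagrange interpolation at all nodes. -/
theorem sum_prod_mul_vandermonde_eq_zero {n : ℕ} {q : ℂ} {X : Fin n → ℂ} (hq0 : q ≠ 0)
    (hq1 : ‖q‖ < 1) (hX : ∀ r, X r ≠ 0)
    (hXX : ∀ r s, r ≠ s → ∀ i : ℤ, X r / X s ≠ q ^ i) {k : Fin n → ℕ} {P : ℂ[X]}
    (hP : P.natDegree < msum k) :
    ∑ m ∈ Finset.Iic k, (∏ r, P.eval (X r * q ^ m r) / nodeProd q X k r (m r)) *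
      ∏ r, ∏ s ∈ Finset.Ioi r, (X s * q ^ m s - X r * q ^ m r) = 0 := by
  set g : Fin n → ℕ → Fin n → ℂ := fun r i s =>
    P.eval (X r * q ^ i) / nodeProd q X k r i * (X r * q ^ i) ^ (s : ℕ) with hg
  have hpi : Finset.Iic k = Fintype.piFinset fun r => Finset.range (k r + 1) := by
    ext m; simp [Pi.le_def]
  have hexp := (Matrix.detRowAlternating (R := ℂ) (n := Fin n)).toMultilinearMap.map_sum_finset
    g fun r => Finset.range (k r + 1)
  have hterm : ∀ m : Fin n → ℕ, Matrix.detRowAlternating (R := ℂ) (fun r => g r (m r)) =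
      (∏ r, P.eval (X r * q ^ m r) / nodeProd q X k r (m r)) *
        ∏ r, ∏ s ∈ Finset.Ioi r, (X s * q ^ m s - X r * q ^ m r) := by
    intro m
    rw [← Matrix.det_vandermonde fun r => X r * q ^ m r, ← Matrix.det_mul_column]
    rfl
  have hdet : Matrix.det (Matrix.of fun r s => ∑ i ∈ Finset.range (k r + 1), g r i s) = 0 := by
    have hn : Nonempty (Fin n) := by
      by_contra hne
      rw [not_nonempty_iff] at hne
      simp [msum] at hP
    refine Matrix.exists_vecMul_eq_zero_iff.1 ⟨fun _ => 1, ?_, ?_⟩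
    · exact fun h => one_ne_zero (congrFun h hn.some)
    · ext s
      have hcard : (nodes k).card = msum k + n := by
        simp [nodes, msum, Finset.sum_add_distrib]
      -- the sum of the rows is a sum over all `|k| + n` nodes
      have key := sum_eval_div_prod_eq_zero (s := nodes k) (P := P * Polynomial.X ^ (s : ℕ))
        ((injective_node hq0 hq1 hX hXX).injOn) (by
          have h1 : (P * Polynomial.X ^ (s : ℕ)).natDegree ≤ P.natDegree + s :=
            (natDegree_mul_le).trans (by rw [natDegree_X_pow])
          have := s.2
          omega)
      rw [nodes, Finset.sum_sigma] at key
      simp only [Matrix.vecMul, dotProduct, one_mul, Matrix.of_apply, Pi.zero_apply]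
      rw [← key]
      refine Finset.sum_congr rfl fun r _ => Finset.sum_congr rfl fun i _ => ?_
      simp only [hg, nodeProd, eval_mul, eval_pow, eval_X, nodes]
      ring
  rw [hpi, ← Finset.sum_congr rfl fun m _ => hterm m]
  refine Eq.trans hexp.symm ?_
  rw [← hdet]
  refine congrArg Matrix.det ?_
  ext r s
  simp

open Polynomial in
/-- The terminating `A_n` summation with value zero that underlies the matrix inversion. -/
theorem sum_vandA_mul_eval_eq_zero {n : ℕ} {q : ℂ} {X : Fin n → ℂ} (hq0 : q ≠ 0)
    (hq1 : ‖q‖ < 1) (hX : ∀ r, X r ≠ 0)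
    (hXX : ∀ r s, r ≠ s → ∀ i : ℤ, X r / X s ≠ q ^ i) {k : Fin n → ℕ} {P : ℂ[X]}
    (hP : P.natDegree < msum k) :
    ∑ m ∈ Finset.Iic k, vandA q X m *
      (∏ r, ∏ s, qrf q (q ^ (-(k s : ℤ)) * (X r / X s)) (m r) /
        qrf q (q * (X r / X s)) (m r)) *
      q ^ (∑ r : Fin n, ((r : ℕ) + 1) * m r) * ∏ r, P.eval (X r * q ^ m r) = 0 := by
  have hinj := injective_node hq0 hq1 hX hXX
  have hD : ∀ r i, nodeProd q X k r i ≠ 0 := by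
    intro r i
    refine Finset.prod_ne_zero_iff.2 fun z hz => sub_ne_zero.2 fun h => ?_
    exact (Finset.ne_of_mem_erase hz) (@hinj ⟨r, i⟩ z h).symm
  have hden : ∀ r s (i : ℕ), qrf q (q * (X r / X s)) i ≠ 0 := by
    intro r s i
    refine qrf_ne_zero fun t h => ?_
    have h1 : X s * q ^ 0 = X r * q ^ (t + 1) := by
      have := hX s
      field_simp at h
      linear_combination h
    have h2 := @hinj ⟨s, 0⟩ ⟨r, t + 1⟩ h1
    simp at h2
  have hw : ∀ r i, i ≤ k r → q ^ i * ∏ s, qrf q (q ^ (-(k s : ℤ)) * (X r / X s)) i /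
      qrf q (q * (X r / X s)) i = nodeProd q X k r 0 / nodeProd q X k r i := by
    intro r i hi
    rw [Finset.prod_div_distrib, ← mul_div_assoc,
      div_eq_div_iff (Finset.prod_ne_zero_iff.2 fun s _ => hden r s i) (hD r i)]
    linear_combination nodeProd_mul hq0 hX hi
  have hterm : ∀ m ∈ Finset.Iic k, vandA q X m *
      (∏ r, ∏ s, qrf q (q ^ (-(k s : ℤ)) * (X r / X s)) (m r) /
        qrf q (q * (X r / X s)) (m r)) *
      q ^ (∑ r : Fin n, ((r : ℕ) + 1) * m r) * ∏ r, P.eval (X r * q ^ m r) =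
      (∏ r, nodeProd q X k r 0) / (∏ r, ∏ s ∈ Finset.Ioi r, (X s - X r)) *
      ((∏ r, P.eval (X r * q ^ m r) / nodeProd q X k r (m r)) *
        ∏ r, ∏ s ∈ Finset.Ioi r, (X s * q ^ m s - X r * q ^ m r)) := by
    intro m hm
    have hm' : m ≤ k := Finset.mem_Iic.1 hm
    have h1 := Finset.prod_congr rfl fun r (_ : r ∈ Finset.univ) => hw r (m r) (hm' r)
    rw [Finset.prod_mul_distrib, Finset.prod_pow_eq_pow_sum, Finset.prod_div_distrib] at h1
    simp only [add_mul, one_mul, Finset.sum_add_distrib, pow_add]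
    have h2 := vandA_mul_pow hq0 hX m
    rw [Finset.prod_div_distrib]
    calc _ = (vandA q X m * q ^ (∑ r : Fin n, (r : ℕ) * m r)) *
          (q ^ (∑ r, m r) * ∏ r, ∏ s, qrf q (q ^ (-(k s : ℤ)) * (X r / X s)) (m r) /
            qrf q (q * (X r / X s)) (m r)) * ∏ r, P.eval (X r * q ^ m r) := by ring
      _ = _ := by rw [h1, h2]; ring
  rw [Finset.sum_congr rfl hterm, ← Finset.mul_sum,
    sum_prod_mul_vandermonde_eq_zero hq0 hq1 hX hXX hP, mul_zero]

/-! ### Factorization of the inverse matrix times a left-hand term -/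

theorem qrf_zero_left (q : ℂ) (k : ℕ) : qrf q 0 k = 1 := by simp [qrf]

theorem one_sub_zpow_mul_ne_zero {n : ℕ} {q : ℂ} {x : Fin n → ℂ}
    (hxx : ∀ r s, r ≠ s → ∀ i : ℤ, x r / x s ≠ q ^ i) {r s : Fin n} (hrs : r ≠ s) (e : ℤ) :
    1 - q ^ e * (x r / x s) ≠ 0 := by
  intro h
  refine hxx r s hrs (-e) ?_
  rw [zpow_neg]
  exact eq_inv_of_mul_eq_one_right (by linear_combination -h)

theorem one_sub_pow_ne_zero {q : ℂ} (hq1 : ‖q‖ < 1) (i : ℕ) : 1 - q * q ^ i ≠ 0 := by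
  intro h
  have h1 : ‖q * q ^ i‖ = 1 := by rw [← sub_eq_zero.1 h, norm_one]
  rw [← pow_succ', norm_pow] at h1
  exact (pow_lt_one₀ (norm_nonneg q) hq1 (Nat.succ_ne_zero i)).ne h1

theorem qrf_zpow_mul_ne_zero {n : ℕ} {q : ℂ} {x : Fin n → ℂ} (hq0 : q ≠ 0) (hq1 : ‖q‖ < 1)
    (hx : ∀ r, x r ≠ 0) (hxx : ∀ r s, r ≠ s → ∀ i : ℤ, x r / x s ≠ q ^ i)
    (j : Fin n → ℕ) (r s : Fin n) (m : ℕ) :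
    qrf q (q ^ (1 + (j r : ℤ) - (j s : ℤ)) * (x r / x s)) m ≠ 0 := by
  refine qrf_ne_zero fun i => ?_
  obtain rfl | hrs := eq_or_ne r s
  · rw [div_self (hx r), add_sub_cancel_right, zpow_one, mul_one]
    exact one_sub_pow_ne_zero hq1 i
  · rw [mul_right_comm, ← zpow_natCast, ← zpow_add₀ hq0]
    exact one_sub_zpow_mul_ne_zero hxx hrs _

theorem qrf_mul_div_ne_zero {n : ℕ} {q : ℂ} {x : Fin n → ℂ} (hq0 : q ≠ 0) (hq1 : ‖q‖ < 1)
    (hx : ∀ r, x r ≠ 0) (hxx : ∀ r s, r ≠ s → ∀ i : ℤ, x r / x s ≠ q ^ i)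
    (r s : Fin n) (m : ℕ) : qrf q (q * (x r / x s)) m ≠ 0 := by
  simpa using qrf_zpow_mul_ne_zero hq0 hq1 hx hxx 0 r s m

/-- The coefficients, for fixed `k`, of the values `F (q ^ M)` in the expansion
`F y = ∑ k, outerTerm q a x y k * ∑ M ≤ k, inverseTerm q a x k M * F (q ^ M)` at the points
`y = q ^ N`; as a matrix, the inverse of `outerTerm q a x (q ^ N) k`. -/
noncomputable def inverseTerm {n : ℕ} (q a : ℂ) (x : Fin n → ℂ) (k M : Fin n → ℕ) : ℂ :=
  vandA q x M *
  (∏ r, ∏ s, qrf q (q ^ (-(k s : ℤ)) * (x r / x s)) (M r) / qrf q (q * (x r / x s)) (M r)) *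
  (∏ r, qrf q (a * x r * q ^ msum k) (M r) / qrf q (a * q * x r) (M r)) *
  q ^ (∑ r : Fin n, ((r : ℕ) + 1) * M r)

/-- The factor with `r = s` and `i = N_r` vanishes when `N_r < j_r`. -/
theorem yFactor_qpt_eq_zero {n : ℕ} {q : ℂ} {x : Fin n → ℂ} (hx : ∀ r, x r ≠ 0)
    {j N : Fin n → ℕ} (h : ¬ j ≤ N) : yFactor q x (qpt q N) j = 0 := by
  obtain ⟨r, hr⟩ := not_forall.1 h
  refine Finset.prod_eq_zero (Finset.mem_univ r) (Finset.prod_eq_zero (Finset.mem_univ r)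
    (Finset.prod_eq_zero (Finset.mem_range.2 (not_le.1 hr)) ?_))
  simp [qpt, div_self (hx r)]

/-- The factor `(q ^ (-k_r))_{M_r}` vanishes for `M_r > k_r`. -/
theorem inverseTerm_eq_zero {n : ℕ} {q : ℂ} (a : ℂ) {x : Fin n → ℂ} (hq0 : q ≠ 0)
    (hx : ∀ r, x r ≠ 0) {k M : Fin n → ℕ} (h : ¬ M ≤ k) : inverseTerm q a x k M = 0 := by
  obtain ⟨r, hr⟩ := not_forall.1 h
  have h1 : qrf q (q ^ (-(k r : ℤ)) * (x r / x r)) (M r) = 0 := by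
    refine Finset.prod_eq_zero (Finset.mem_range.2 (not_le.1 hr)) ?_
    rw [div_self (hx r), mul_one, zpow_neg, zpow_natCast,
      inv_mul_cancel₀ (pow_ne_zero _ hq0), sub_self]
  have h2 : ∏ r, ∏ s, qrf q (q ^ (-(k s : ℤ)) * (x r / x s)) (M r) /
      qrf q (q * (x r / x s)) (M r) = 0 :=
    Finset.prod_eq_zero (Finset.mem_univ r) (Finset.prod_eq_zero (Finset.mem_univ r)
      (by rw [h1, zero_div]))
  rw [inverseTerm, h2]
  ring

theorem vandA_mul_ratio {n : ℕ} {q : ℂ} {x : Fin n → ℂ}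
    (hxx : ∀ r s, r ≠ s → ∀ i : ℤ, x r / x s ≠ q ^ i) (j m : Fin n → ℕ) :
    vandA q x j * (∏ r, ∏ s ∈ Finset.Ioi r,
      (1 - q ^ ((j r : ℤ) - (j s : ℤ) + (m r : ℤ) - (m s : ℤ)) * (x r / x s)) /
        (1 - q ^ ((j r : ℤ) - (j s : ℤ)) * (x r / x s))) = vandA q x (j + m) := by
  simp only [vandA, ← Finset.prod_mul_distrib]
  refine Finset.prod_congr rfl fun r _ => Finset.prod_congr rfl fun s hs => ?_
  have h := one_sub_zpow_mul_ne_zero hxx (Finset.mem_Ioi.1 hs).ne ((j r : ℤ) - (j s : ℤ))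
  have e : (((j + m) r : ℕ) : ℤ) - ((j + m) s : ℕ) =
      (j r : ℤ) - (j s : ℤ) + (m r : ℤ) - (m s : ℤ) := by
    simp only [Pi.add_apply]; push_cast; ring
  rw [e, div_mul_div_comm, mul_comm (1 - x r / x s), mul_div_mul_left _ _ h]

/-- The factors of the middle and inner terms that involve `b` combine to the denominator of
`lhsTerm` at `y = q ^ (j + m)`. -/
theorem prod_qrf_typeC {n : ℕ} {q b : ℂ} {x : Fin n → ℂ}
    (hb : ∀ r s, ∀ i : ℕ, 1 - b * x r * x s * q ^ i ≠ 0) (j m : Fin n → ℕ) :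
    (∏ r, ∏ s, qrf q (b * q * x r * x s) (j r) / qrf q (b * q * x r * x s) (j r + j s)) *
      (∏ r, ∏ s, qrf q (b * x r * x s * q ^ (1 + j r)) (m r) /
        qrf q (b * x r * x s * q ^ (1 + j r + j s)) (m r)) =
      (∏ r, ∏ s, qrf q (b * q * x r * x s * qpt q (j + m) s) (j r))⁻¹ := by
  rw [Finset.prod_comm (f := fun r s => qrf q (b * q * x r * x s * qpt q (j + m) s) (j r))]
  simp only [← Finset.prod_mul_distrib, ← Finset.prod_inv_distrib]
  refine Finset.prod_congr rfl fun r _ => Finset.prod_congr rfl fun s _ => ?_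
  have hne : ∀ e i : ℕ, qrf q (b * x r * x s * q ^ e) i ≠ 0 := by
    intro e i
    refine qrf_ne_zero fun t => ?_
    rw [mul_assoc, ← pow_add]
    exact hb r s _
  have e0 : b * q * x r * x s = b * x r * x s * q ^ 1 := by ring
  have e1 : b * q * x s * x r * qpt q (j + m) r = b * x r * x s * q ^ (1 + (j r + m r)) := by
    simp only [qpt, Pi.add_apply]; ring
  rw [e0, e1, div_mul_div_comm, inv_eq_one_div,
    div_eq_div_iff (mul_ne_zero (hne _ _) (hne _ _)) (hne _ _)]
  have h : ∀ e u v : ℕ, qrf q (b * x r * x s * q ^ e) (u + v) =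
      qrf q (b * x r * x s * q ^ e) u * qrf q (b * x r * x s * q ^ (e + u)) v := by
    intro e u v
    rw [qrf_add, mul_assoc (b * x r * x s), ← pow_add]
  rw [add_assoc 1 (j r) (j s), one_mul, ← h, ← h, ← h]
  congr 1
  ring

/-- The terms of the two inner sums with `j + m = M` are the product of the coefficient
`inverseTerm` at `M` with the `j`-th term of the left-hand side at `y = q ^ M`. -/
theorem middleTerm_mul_innerTerm {n : ℕ} {q b : ℂ} (a : ℂ) {x : Fin n → ℂ}
    (hq0 : q ≠ 0) (hq1 : ‖q‖ < 1) (hx : ∀ r, x r ≠ 0)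
    (hxx : ∀ r s, r ≠ s → ∀ i : ℤ, x r / x s ≠ q ^ i)
    (hb : ∀ r s, ∀ i : ℕ, 1 - b * x r * x s * q ^ i ≠ 0)
    (K : (Fin n → ℂ) → ℂ) (β : (Fin n → ℕ) → ℂ) (k j m : Fin n → ℕ) :
    middleTerm q a b x β k j * innerTerm q a b x K k j m =
      inverseTerm q a x k (j + m) *
        (K (qpt q (j + m)) * lhsTerm q b x β (qpt q (j + m)) j) := by
  have hV := vandA_mul_ratio hxx j m
  have hB := prod_qrf_typeC hb j m
  have hKey := vandA_yFactor_mul hq0 hx hxx j m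
  have hA : (∏ r, qrf q (a * x r * q ^ msum k) (j r)) *
      (∏ r, qrf q (a * x r * q ^ (j r + msum k)) (m r)) =
      ∏ r, qrf q (a * x r * q ^ msum k) (j r + m r) := by
    rw [← Finset.prod_mul_distrib]
    refine Finset.prod_congr rfl fun r _ => ?_
    rw [qrf_add, mul_assoc (a * x r), ← pow_add, add_comm (j r)]
  have hN : (∏ r, ∏ s, qrf q (q ^ (-(k s : ℤ)) * (x r / x s)) (j r)) *
      (∏ r, ∏ s, qrf q (q ^ ((j r : ℤ) - (k s : ℤ)) * (x r / x s)) (m r)) =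
      ∏ r, ∏ s, qrf q (q ^ (-(k s : ℤ)) * (x r / x s)) (j r + m r) := by
    simp only [← Finset.prod_mul_distrib]
    refine Finset.prod_congr rfl fun r _ => Finset.prod_congr rfl fun s _ => ?_
    rw [qrf_zpow_add hq0, neg_add_eq_sub]
  have hF1 : ∏ r, ∏ s, qrf q (q ^ (1 + (j r : ℤ) - (j s : ℤ)) * (x r / x s)) (m r) ≠ 0 :=
    Finset.prod_ne_zero_iff.2 fun r _ => Finset.prod_ne_zero_iff.2 fun s _ =>
      qrf_zpow_mul_ne_zero hq0 hq1 hx hxx j r s _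
  have hF2 : ∏ r, ∏ s, qrf q (q * (x r / x s)) (j r + m r) ≠ 0 :=
    Finset.prod_ne_zero_iff.2 fun r _ => Finset.prod_ne_zero_iff.2 fun s _ =>
      qrf_mul_div_ne_zero hq0 hq1 hx hxx r s _
  have hKey' : (-1) ^ msum j * q ^ (msum j).choose 2 /
      (∏ r, ∏ s, qrf q (q ^ (1 + (j r : ℤ) - (j s : ℤ)) * (x r / x s)) (m r)) =
      vandA q x j * yFactor q x (qpt q (j + m)) j * q ^ (∑ r : Fin n, (r : ℕ) * j r) /
        ∏ r, ∏ s, qrf q (q * (x r / x s)) (j r + m r) := by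
    rw [div_eq_div_iff hF1 hF2, hKey]
  simp only [middleTerm, innerTerm, inverseTerm, lhsTerm, Pi.add_apply, mul_add,
    Finset.sum_add_distrib, pow_add, Finset.prod_div_distrib, Finset.prod_mul_distrib] at *
  rw [← hV, ← hA, ← hN, div_eq_mul_inv _ (∏ r, ∏ s, qrf q (b * q * x r * x s * _) (j r)), ← hB]
  linear_combination (vandA q x j * (
    (∏ r, ∏ s ∈ Finset.Ioi r,
      (1 - q ^ ((j r : ℤ) - (j s : ℤ) + (m r : ℤ) - (m s : ℤ)) * (x r / x s))) /
      ∏ r, ∏ s ∈ Finset.Ioi r, (1 - q ^ ((j r : ℤ) - (j s : ℤ)) * (x r / x s)))) *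
    vandC q b x j *
    ((∏ r, qrf q (a * x r * q ^ msum k) (j r)) *
      ∏ r, qrf q (a * x r * (q ^ j r * q ^ msum k)) (m r)) *
    ((∏ r, ∏ s, qrf q (q ^ (-(k s : ℤ)) * (x r / x s)) (j r)) *
      ∏ r, ∏ s, qrf q (q ^ ((j r : ℤ) - (k s : ℤ)) * (x r / x s)) (m r)) *
    (((∏ r, ∏ s, qrf q (b * q * x r * x s) (j r)) /
        ∏ r, ∏ s, qrf q (b * q * x r * x s) (j r + j s)) *
      ((∏ r, ∏ s, qrf q (b * x r * x s * (q ^ 1 * q ^ j r)) (m r)) /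
        ∏ r, ∏ s, qrf q (b * x r * x s * (q ^ 1 * q ^ j r * q ^ j s)) (m r))) *
    (q ^ (∑ r : Fin n, ((r : ℕ) + 1) * j r) * q ^ (∑ r : Fin n, ((r : ℕ) + 1) * m r)) *
    (K (qpt q (j + m)) * β j / ∏ r, qrf q (a * q * x r) (j r + m r)) * hKey'

/-! ### Matrix inversion -/

theorem mul_qpow_div_mul_qpow {n : ℕ} {q : ℂ} {x : Fin n → ℂ} (hq0 : q ≠ 0) (l : Fin n → ℕ)
    (r s : Fin n) :
    x r * q ^ l r / (x s * q ^ l s) = q ^ ((l r : ℤ) - (l s : ℤ)) * (x r / x s) := by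
  rw [zpow_sub₀ hq0, zpow_natCast, zpow_natCast, mul_div_mul_comm, mul_comm]

/-- The outer factor contains the `b = 0` case of `lhsTerm`, so that `middleTerm_mul_innerTerm` also
applies to the product of `inverseTerm` and `outerTerm`. -/
theorem outerTerm_eq_lhsTerm_mul {n : ℕ} (q a : ℂ) (x y : Fin n → ℂ) (l : Fin n → ℕ) :
    outerTerm q a x y l = lhsTerm q 0 x 1 y l *
      ((∏ r, ((1 - a * x r * q ^ (l r + msum l)) * qrf q (a * x r) (msum l)) / (1 - a * x r)) /
        (∏ r, ∏ s, qrf q (q * (x r / x s)) (l r))) *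
      ∏ r, (qrf q (a * q * x r * y r) (msum l))⁻¹ := by
  have hC : vandC q 0 x l = 1 := by simp [vandC]
  have h1 : ∀ r : Fin n, ((1 - a * x r * q ^ (l r + msum l)) * qrf q (a * x r) (msum l)) /
      ((1 - a * x r) * qrf q (a * q * x r * y r) (msum l)) =
      ((1 - a * x r * q ^ (l r + msum l)) * qrf q (a * x r) (msum l)) / (1 - a * x r) *
        (qrf q (a * q * x r * y r) (msum l))⁻¹ := fun r => by
    rw [← div_div, div_eq_mul_inv (_ / _)]
  simp only [outerTerm, lhsTerm, hC, h1, zero_mul, qrf_zero_left, Finset.prod_const_one, div_one,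
    mul_one, Pi.one_apply, Finset.prod_mul_distrib]
  ring

/-- For `b = 0` and `K = 1` the inner term has the shape of a term of the `A_n` sum in
`sum_vandA_mul_eval_eq_zero`, with `x_r q ^ l_r` and `k - l` in place of `X_r` and `k`. -/
theorem innerTerm_zero_eq {n : ℕ} {q : ℂ} (a : ℂ) {x : Fin n → ℂ} (hq0 : q ≠ 0)
    {k l : Fin n → ℕ} (hlk : l ≤ k) (m : Fin n → ℕ) :
    innerTerm q a 0 x 1 k l m =
      vandA q (fun r => x r * q ^ l r) m *
      (∏ r, ∏ s, qrf q (q ^ (-((k - l) s : ℤ)) * (x r * q ^ l r / (x s * q ^ l s))) (m r) /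
        qrf q (q * (x r * q ^ l r / (x s * q ^ l s))) (m r)) *
      q ^ (∑ r : Fin n, ((r : ℕ) + 1) * m r) *
      ∏ r, qrf q (a * x r * q ^ (l r + msum k)) (m r) / qrf q (a * q * x r) (l r + m r) := by
  simp only [innerTerm, zero_mul, qrf_zero_left, mul_one, Pi.one_apply, vandA,
    mul_qpow_div_mul_qpow hq0, ← mul_assoc, ← zpow_add₀ hq0]
  have e1 : ∀ r s : Fin n, -(((k - l) s : ℕ) : ℤ) + ((l r : ℤ) - (l s : ℤ)) =
      (l r : ℤ) - (k s : ℤ) := by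
    intro r s
    rw [Pi.sub_apply, Nat.cast_sub (hlk s)]; ring
  have e2 : ∀ r s : Fin n, (m r : ℤ) - (m s : ℤ) + ((l r : ℤ) - (l s : ℤ)) =
      (l r : ℤ) - (l s : ℤ) + (m r : ℤ) - (m s : ℤ) := fun r s => by ring
  have e3 : ∀ r s : Fin n, q * q ^ ((l r : ℤ) - (l s : ℤ)) =
      q ^ (1 + (l r : ℤ) - (l s : ℤ)) := fun r s => by
    rw [add_sub_assoc, zpow_add₀ hq0, zpow_one]
  simp only [e1, e2, e3]
  ring

open Polynomial in
/-- `∏_{i < d} (1 - c q ^ i z)` as a polynomial in `z`. -/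
noncomputable def qrfPoly (q c : ℂ) (d : ℕ) : ℂ[X] :=
  ∏ i ∈ Finset.range d, (1 - C (c * q ^ i) * X)

open Polynomial in
theorem eval_qrfPoly (q c : ℂ) (d : ℕ) (z : ℂ) : (qrfPoly q c d).eval z = qrf q (c * z) d := by
  simp [qrfPoly, qrf, eval_prod, mul_right_comm]

open Polynomial in
theorem natDegree_qrfPoly_le (q c : ℂ) (d : ℕ) : (qrfPoly q c d).natDegree ≤ d := by
  refine (natDegree_prod_le _ _).trans ?_
  calc _ ≤ ∑ _i ∈ Finset.range d, 1 := Finset.sum_le_sum fun i _ =>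
        (natDegree_sub_le _ _).trans (max_le (by simp)
          ((natDegree_C_mul_le _ _).trans natDegree_X_le))
    _ = d := by simp

/-- As a function of `m`, the left-hand side is a polynomial of degree at most `d` in `q ^ m`. -/
theorem qrf_div_mul_inv {q A : ℂ} (h : ∀ i : ℕ, 1 - A * q ^ i ≠ 0) {u v w m : ℕ} (d : ℕ)
    (hw : w = v + 1 + d) :
    qrf q (A * q ^ (u + w)) m / qrf q (A * q) (u + m) * (qrf q (A * q * q ^ (u + m)) v)⁻¹ =
      (qrf q (A * q) (u + (v + d)))⁻¹ * qrf q (A * q ^ (1 + v) * q ^ (u + m)) d := by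
  have hne : ∀ e i : ℕ, qrf q (A * q ^ e) i ≠ 0 := by
    intro e i
    refine qrf_ne_zero fun t => ?_
    rw [mul_assoc, ← pow_add]
    exact h _
  have hadd : ∀ e u v : ℕ, qrf q (A * q ^ e) (u + v) =
      qrf q (A * q ^ e) u * qrf q (A * q ^ (e + u)) v := by
    intro e u v
    rw [qrf_add, mul_assoc A, ← pow_add]
  have e1 : A * q * q ^ (u + m) = A * q ^ (1 + (u + m)) := by ring
  have e2 : A * q ^ (1 + v) * q ^ (u + m) = A * q ^ (1 + (u + m) + v) := by ring
  have e3 : A * q = A * q ^ 1 := by ring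
  have h1 := hadd 1 (u + m) (v + d)
  have h2 := hadd (1 + (u + m)) v d
  have h3 := hadd 1 (u + (v + d)) m
  have e4 : u + w = 1 + (u + (v + d)) := by omega
  have e5 : u + m + (v + d) = u + (v + d) + m := by omega
  rw [e1, e2, e3, e4, div_mul_eq_mul_div, div_eq_iff (hne _ _), mul_inv_eq_iff_eq_mul₀ (hne _ _),
    mul_assoc, mul_assoc, eq_inv_mul_iff_mul_eq₀ (hne _ _), ← h3, ← e5, h1, h2]
  ring

theorem sum_Icc_eq_sum_Iic_sub {n : ℕ} {l k : Fin n → ℕ} (h : l ≤ k) (f : (Fin n → ℕ) → ℂ) :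
    ∑ M ∈ Finset.Icc l k, f M = ∑ m ∈ Finset.Iic (k - l), f (l + m) := by
  refine (Finset.sum_nbij' (fun m => l + m) (fun M => M - l) ?_ ?_ ?_ ?_ ?_).symm
  · intro m hm
    rw [Finset.mem_Iic] at hm
    exact Finset.mem_Icc.2 ⟨le_self_add, (add_le_add_right hm l).trans (add_tsub_cancel_of_le h).le⟩
  · intro M hM
    exact Finset.mem_Iic.2 (tsub_le_tsub_right (Finset.mem_Icc.1 hM).2 l)
  · intro m _
    exact add_tsub_cancel_left l m
  · intro M hM
    exact add_tsub_cancel_of_le (Finset.mem_Icc.1 hM).1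
  · intro m _; rfl

theorem inverseTerm_mul_outerTerm_self {n : ℕ} {q a : ℂ} {x : Fin n → ℂ}
    (hq0 : q ≠ 0) (hq1 : ‖q‖ < 1) (hx : ∀ r, x r ≠ 0)
    (hxx : ∀ r s, r ≠ s → ∀ i : ℤ, x r / x s ≠ q ^ i)
    (ha : ∀ r, ∀ i : ℕ, 1 - a * x r * q ^ i ≠ 0) (k : Fin n → ℕ) :
    inverseTerm q a x k k * outerTerm q a x (qpt q k) k = 1 := by
  have hF : ∏ r, ∏ s, qrf q (q * (x r / x s)) (k r) ≠ 0 :=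
    Finset.prod_ne_zero_iff.2 fun r _ => Finset.prod_ne_zero_iff.2 fun s _ =>
      qrf_mul_div_ne_zero hq0 hq1 hx hxx r s _
  have hKey := vandA_yFactor_mul hq0 hx hxx k 0
  simp only [add_zero, Pi.zero_apply, qrf, Finset.range_zero, Finset.prod_empty,
    Finset.prod_const_one, mul_one] at hKey
  simp only [← qrf.eq_1] at hKey
  have hy : yFactor q x (qpt q k) k =
      q ^ (msum k ^ 2) * ∏ r, ∏ s, qrf q (q ^ (-(k s : ℤ)) * (x r / x s)) (k r) := by
    rw [sq]
    nth_rewrite 1 [msum]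
    rw [msum, Finset.sum_mul_sum]
    simp only [yFactor, ← Finset.prod_pow_eq_pow_sum, ← Finset.prod_mul_distrib]
    refine Finset.prod_congr rfl fun r _ => Finset.prod_congr rfl fun s _ => ?_
    rw [mul_comm (k r), pow_mul, ← Finset.card_range (k r), ← Finset.prod_const,
      Finset.card_range, qrf, ← Finset.prod_mul_distrib]
    refine Finset.prod_congr rfl fun i _ => ?_
    rw [qpt, zpow_neg, zpow_natCast, mul_sub, mul_assoc (q ^ k s)⁻¹,
      mul_inv_cancel_left₀ (pow_ne_zero _ hq0), mul_one]
  have hA : (∏ r, qrf q (a * x r * q ^ msum k) (k r) / qrf q (a * q * x r) (k r)) *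
      (∏ r, ((1 - a * x r * q ^ (k r + msum k)) * qrf q (a * x r) (msum k)) /
        ((1 - a * x r) * qrf q (a * q * x r * qpt q k r) (msum k))) = 1 := by
    rw [← Finset.prod_mul_distrib]
    refine Finset.prod_eq_one fun r _ => ?_
    have h1 : qrf q (a * x r) (msum k + k r + 1) = qrf q (a * x r) (msum k) *
        qrf q (a * x r * q ^ msum k) (k r) * (1 - a * x r * q ^ (k r + msum k)) := by
      rw [qrf_succ, qrf_add, add_comm (k r)]
    have h2 : qrf q (a * x r) (msum k + k r + 1) = (1 - a * x r) *
        (qrf q (a * q * x r) (k r) * qrf q (a * q * x r * qpt q k r) (msum k)) := by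
      rw [qrf_succ', add_comm (msum k), qrf_add, mul_right_comm a, qpt]
    have h0 : qrf q (a * x r) (msum k + k r + 1) ≠ 0 := qrf_ne_zero (ha r)
    rw [div_mul_div_comm, div_eq_one_iff_eq]
    · linear_combination h2 - h1
    · rw [h2] at h0
      intro h
      exact h0 (by linear_combination h)
  have hs : ((-1) ^ msum k * q ^ (msum k).choose 2 : ℂ) ^ 2 * q ^ msum k = q ^ (msum k ^ 2) := by
    rw [mul_pow, ← pow_mul, mul_comm (msum k) 2, pow_mul, neg_one_sq, one_pow, one_mul, ← pow_mul,
      ← pow_add, mul_comm _ 2, two_mul_choose_two_add]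
  rw [hy] at hKey
  have hq : q ^ (msum k ^ 2) ≠ 0 := pow_ne_zero _ hq0
  have hexp : q ^ (∑ r : Fin n, ((r : ℕ) + 1) * k r) =
      q ^ (∑ r : Fin n, (r : ℕ) * k r) * q ^ msum k := by
    simp only [add_mul, one_mul, Finset.sum_add_distrib, pow_add, msum]
  simp only [inverseTerm, outerTerm, hy, hexp, Finset.prod_div_distrib] at hA ⊢
  set F := ∏ r, ∏ s, qrf q (q * (x r / x s)) (k r)
  set G := ∏ r, ∏ s, qrf q (q ^ (-(k s : ℤ)) * (x r / x s)) (k r)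
  set V := vandA q x k
  set E := q ^ (∑ r : Fin n, (r : ℕ) * k r)
  set S : ℂ := (-1) ^ msum k * q ^ (msum k).choose 2
  set Q := q ^ (msum k ^ 2)
  have h1 : V * (G / F) * E * (V * (Q * G) / F * E) * q ^ msum k = 1 := by
    have h3 : V * (G / F) * E = S / Q := by
      field_simp
      linear_combination hKey
    have h4 : V * (Q * G) / F * E = S := by
      field_simp
      linear_combination hKey
    rw [h3, h4, ← div_self hq, ← hs]
    ring
  have h5 := congrArg₂ (fun u v : ℂ => u * v) h1 hA
  simp only [mul_one] at h5
  linear_combination h5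

/-- The off-diagonal entries of the product of the two matrices. The polynomial `P` in the vanishing
`A_n` sum has degree at most `|k| - |l| - 1`. -/
theorem sum_inverseTerm_mul_outerTerm_eq_zero {n : ℕ} {q a : ℂ} {x : Fin n → ℂ}
    (hq0 : q ≠ 0) (hq1 : ‖q‖ < 1) (hx : ∀ r, x r ≠ 0)
    (hxx : ∀ r s, r ≠ s → ∀ i : ℤ, x r / x s ≠ q ^ i)
    (ha : ∀ r, ∀ i : ℕ, 1 - a * x r * q ^ i ≠ 0) {l k : Fin n → ℕ} (hlk : l < k) :
    ∑ m ∈ Finset.Iic (k - l),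
      inverseTerm q a x k (l + m) * outerTerm q a x (qpt q (l + m)) l = 0 := by
  have hsub : msum l + msum (k - l) = msum k := by
    rw [msum, msum, ← Finset.sum_add_distrib]
    exact Finset.sum_congr rfl fun r _ => Nat.add_sub_of_le (hlk.le r)
  have hpos : 0 < msum (k - l) := by
    obtain ⟨r, hr⟩ := (Pi.lt_def.1 hlk).2
    exact lt_of_lt_of_le (Nat.sub_pos_of_lt hr)
      (Finset.single_le_sum (f := k - l) (fun s _ => Nat.zero_le _) (Finset.mem_univ r))
  obtain ⟨d, hd⟩ := Nat.exists_eq_add_of_lt hpos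
  rw [zero_add] at hd
  set X : Fin n → ℂ := fun r => x r * q ^ l r with hXdef
  have hX : ∀ r, X r ≠ 0 := fun r => mul_ne_zero (hx r) (pow_ne_zero _ hq0)
  have hXX : ∀ r s, r ≠ s → ∀ i : ℤ, X r / X s ≠ q ^ i := by
    intro r s hrs i h
    have h1 := one_sub_zpow_mul_ne_zero hxx hrs ((l r : ℤ) - (l s : ℤ) - i)
    rw [zpow_sub₀ hq0, div_mul_eq_mul_div, ← mul_qpow_div_mul_qpow hq0] at h1
    refine h1 ?_
    change 1 - X r / X s / q ^ i = 0
    rw [h, div_self (zpow_ne_zero _ hq0), sub_self]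
  have key := sum_vandA_mul_eval_eq_zero hq0 hq1 hX hXX (k := k - l)
    (P := qrfPoly q (a * q ^ (1 + msum l)) d)
    (lt_of_le_of_lt (natDegree_qrfPoly_le _ _ _) (by omega))
  set c : ℂ := middleTerm q a 0 x 1 k l *
    ((∏ r, ((1 - a * x r * q ^ (l r + msum l)) * qrf q (a * x r) (msum l)) / (1 - a * x r)) /
        (∏ r, ∏ s, qrf q (q * (x r / x s)) (l r))) *
    ∏ r, (qrf q (a * q * x r) (l r + (msum l + d)))⁻¹ with hc
  rw [← mul_zero c, ← key, Finset.mul_sum]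
  refine Finset.sum_congr rfl fun m _ => ?_
  have hP : (∏ r, qrf q (a * x r * q ^ (l r + msum k)) (m r) / qrf q (a * q * x r) (l r + m r)) *
      ∏ r, (qrf q (a * q * x r * qpt q (l + m) r) (msum l))⁻¹ =
      (∏ r, (qrf q (a * q * x r) (l r + (msum l + d)))⁻¹) *
        ∏ r, (qrfPoly q (a * q ^ (1 + msum l)) d).eval (X r * q ^ m r) := by
    simp only [← Finset.prod_mul_distrib]
    refine Finset.prod_congr rfl fun r _ => ?_
    have h := qrf_div_mul_inv (m := m r) (ha r) (u := l r) (v := msum l) (w := msum k) d (by omega)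
    have e1 : a * q ^ (1 + msum l) * (X r * q ^ m r) =
        a * x r * q ^ (1 + msum l) * q ^ (l r + m r) := by
      simp only [hXdef]; ring
    rw [eval_qrfPoly, e1, mul_right_comm a q, qpt, Pi.add_apply]
    exact h
  have hT := middleTerm_mul_innerTerm (b := 0) a hq0 hq1 hx hxx (by simp) 1 1 k l m
  rw [innerTerm_zero_eq a hq0 hlk.le] at hT
  simp only [Pi.one_apply, one_mul] at hT
  rw [outerTerm_eq_lhsTerm_mul, ← mul_assoc, ← mul_assoc, ← hT, hc]
  linear_combination (middleTerm q a 0 x 1 k l *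
    ((∏ r, ((1 - a * x r * q ^ (l r + msum l)) * qrf q (a * x r) (msum l)) / (1 - a * x r)) /
        (∏ r, ∏ s, qrf q (q * (x r / x s)) (l r))) *
    (vandA q X m *
      (∏ r, ∏ s, qrf q (q ^ (-((k - l) s : ℤ)) * (X r / X s)) (m r) /
        qrf q (q * (X r / X s)) (m r)) *
      q ^ (∑ r : Fin n, ((r : ℕ) + 1) * m r))) * hP

theorem sum_inverseTerm_mul_outerTerm {n : ℕ} {q a : ℂ} {x : Fin n → ℂ}
    (hq0 : q ≠ 0) (hq1 : ‖q‖ < 1) (hx : ∀ r, x r ≠ 0)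
    (hxx : ∀ r s, r ≠ s → ∀ i : ℤ, x r / x s ≠ q ^ i)
    (ha : ∀ r, ∀ i : ℕ, 1 - a * x r * q ^ i ≠ 0) {N k : Fin n → ℕ} (hk : k ≤ N)
    (l : Fin n → ℕ) :
    ∑ M ∈ Finset.Iic N, inverseTerm q a x k M * outerTerm q a x (qpt q M) l =
      if k = l then 1 else 0 := by
  have h : ∑ M ∈ Finset.Iic N, inverseTerm q a x k M * outerTerm q a x (qpt q M) l =
      ∑ M ∈ Finset.Icc l k, inverseTerm q a x k M * outerTerm q a x (qpt q M) l := by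
    refine (Finset.sum_subset (fun M hM => Finset.mem_Iic.2
      ((Finset.mem_Icc.1 hM).2.trans hk)) fun M _ hM => ?_).symm
    by_cases h1 : M ≤ k
    · have h2 : ¬ l ≤ M := fun h2 => hM (Finset.mem_Icc.2 ⟨h2, h1⟩)
      rw [outerTerm, yFactor_qpt_eq_zero hx h2]
      ring
    · rw [inverseTerm_eq_zero a hq0 hx h1, zero_mul]
  rw [h]
  obtain rfl | hkl := eq_or_ne k l
  · rw [Finset.Icc_self, Finset.sum_singleton, if_pos rfl,
      inverseTerm_mul_outerTerm_self hq0 hq1 hx hxx ha]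
  · rw [if_neg hkl]
    by_cases hlk : l ≤ k
    · rw [sum_Icc_eq_sum_Iic_sub hlk]
      exact sum_inverseTerm_mul_outerTerm_eq_zero hq0 hq1 hx hxx ha (lt_of_le_of_ne hlk hkl.symm)
    · rw [Finset.Icc_eq_empty hlk, Finset.sum_empty]

/-- The expansion of an arbitrary function at the points `q ^ N`. -/
theorem sum_outerTerm_mul_sum_inverseTerm {n : ℕ} {q a : ℂ} {x : Fin n → ℂ}
    (hq0 : q ≠ 0) (hq1 : ‖q‖ < 1) (hx : ∀ r, x r ≠ 0)
    (hxx : ∀ r s, r ≠ s → ∀ i : ℤ, x r / x s ≠ q ^ i)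
    (ha : ∀ r, ∀ i : ℕ, 1 - a * x r * q ^ i ≠ 0) (N : Fin n → ℕ) (F : (Fin n → ℕ) → ℂ) :
    ∑ k ∈ Finset.Iic N, outerTerm q a x (qpt q N) k *
      ∑ M ∈ Finset.Iic k, inverseTerm q a x k M * F M = F N := by
  classical
  let A : Matrix (Finset.Iic N) (Finset.Iic N) ℂ := fun M k => outerTerm q a x (qpt q M) k
  let B : Matrix (Finset.Iic N) (Finset.Iic N) ℂ := fun k M => inverseTerm q a x k M
  have hBA : B * A = 1 := by
    ext k l
    rw [Matrix.mul_apply, Matrix.one_apply]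
    refine (Finset.sum_coe_sort (Finset.Iic N) fun M => inverseTerm q a x k M *
      outerTerm q a x (qpt q M) l).trans ?_
    rw [sum_inverseTerm_mul_outerTerm hq0 hq1 hx hxx ha (Finset.mem_Iic.1 k.2)]
    simp only [Subtype.ext_iff]
  -- for square matrices a left inverse is a right inverse
  have hAB : A * B = 1 := mul_eq_one_comm.1 hBA
  have h1 : ∀ k ∈ Finset.Iic N, ∑ M ∈ Finset.Iic k, inverseTerm q a x k M * F M =
      ∑ M ∈ Finset.Iic N, inverseTerm q a x k M * F M := by
    intro k hk
    refine Finset.sum_subset (Finset.Iic_subset_Iic.2 (Finset.mem_Iic.1 hk)) fun M _ hM => ?_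
    rw [inverseTerm_eq_zero a hq0 hx (fun h => hM (Finset.mem_Iic.2 h)), zero_mul]
  have h2 := congrFun (congrArg (fun C => C.mulVec fun M => F M) hAB)
    ⟨N, Finset.mem_Iic.2 le_rfl⟩
  simp only [Matrix.one_mulVec, ← Matrix.mulVec_mulVec] at h2
  rw [← h2]
  simp only [Matrix.mulVec, dotProduct]
  rw [← Finset.sum_coe_sort]
  refine Finset.sum_congr rfl fun k _ => ?_
  rw [h1 k k.2, ← Finset.sum_coe_sort]

/-! ### The terminating identity -/

theorem lhsTerm_qpt_eq_zero {n : ℕ} {q b : ℂ} {x : Fin n → ℂ} (hx : ∀ r, x r ≠ 0)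
    (β : (Fin n → ℕ) → ℂ) {j N : Fin n → ℕ} (h : ¬ j ≤ N) :
    lhsTerm q b x β (qpt q N) j = 0 := by
  rw [lhsTerm, yFactor_qpt_eq_zero hx h]
  ring

theorem rhsTerm_qpt_eq_zero {n : ℕ} {q a b : ℂ} {x : Fin n → ℂ} (hx : ∀ r, x r ≠ 0)
    (K : (Fin n → ℂ) → ℂ) (β : (Fin n → ℕ) → ℂ) {k N : Fin n → ℕ} (h : ¬ k ≤ N) :
    rhsTerm q a b x K β (qpt q N) k = 0 := by
  rw [rhsTerm, outerTerm, yFactor_qpt_eq_zero hx h]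
  ring

/-- The two inner sums, reindexed by `M = j + m`, are the coefficients of the expansion of the
left-hand side. -/
theorem sum_middleTerm_mul_sum_innerTerm {n : ℕ} {q a b : ℂ} {x : Fin n → ℂ}
    (hq0 : q ≠ 0) (hq1 : ‖q‖ < 1) (hx : ∀ r, x r ≠ 0)
    (hxx : ∀ r s, r ≠ s → ∀ i : ℤ, x r / x s ≠ q ^ i)
    (hb : ∀ r s, ∀ i : ℕ, 1 - b * x r * x s * q ^ i ≠ 0)
    (K : (Fin n → ℂ) → ℂ) (β : (Fin n → ℕ) → ℂ) (k : Fin n → ℕ) :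
    ∑ j ∈ Finset.Iic k, middleTerm q a b x β k j *
        ∑ m ∈ Finset.Iic (k - j), innerTerm q a b x K k j m =
      ∑ M ∈ Finset.Iic k, inverseTerm q a x k M *
        (K (qpt q M) * ∑ j ∈ Finset.Iic M, lhsTerm q b x β (qpt q M) j) := by
  have h : ∀ j ∈ Finset.Iic k, middleTerm q a b x β k j *
        ∑ m ∈ Finset.Iic (k - j), innerTerm q a b x K k j m =
      ∑ M ∈ Finset.Icc j k, inverseTerm q a x k M *
        (K (qpt q M) * lhsTerm q b x β (qpt q M) j) := by
    intro j hj
    rw [sum_Icc_eq_sum_Iic_sub (Finset.mem_Iic.1 hj), Finset.mul_sum]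
    exact Finset.sum_congr rfl fun m _ => middleTerm_mul_innerTerm a hq0 hq1 hx hxx hb K β k j m
  rw [Finset.sum_congr rfl h]
  simp only [Finset.mul_sum]
  refine Finset.sum_comm' fun j M => ?_
  simp only [Finset.mem_Iic, Finset.mem_Icc]
  exact ⟨fun h => ⟨h.2.1, h.2.2⟩, fun h => ⟨h.1.trans h.2, h.1, h.2⟩⟩

theorem mul_tsum_lhsTerm_qpt {n : ℕ} {q a b : ℂ} {x : Fin n → ℂ}
    (hq0 : q ≠ 0) (hq1 : ‖q‖ < 1) (hx : ∀ r, x r ≠ 0)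
    (hxx : ∀ r s, r ≠ s → ∀ i : ℤ, x r / x s ≠ q ^ i)
    (ha : ∀ r, ∀ i : ℕ, 1 - a * x r * q ^ i ≠ 0)
    (hb : ∀ r s, ∀ i : ℕ, 1 - b * x r * x s * q ^ i ≠ 0)
    (K : (Fin n → ℂ) → ℂ) (β : (Fin n → ℕ) → ℂ) (N : Fin n → ℕ) :
    K (qpt q N) * ∑' j, lhsTerm q b x β (qpt q N) j =
      ∑' k, rhsTerm q a b x K β (qpt q N) k := by
  rw [tsum_eq_sum (s := Finset.Iic N) fun j hj =>
      lhsTerm_qpt_eq_zero hx β fun h => hj (Finset.mem_Iic.2 h),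
    tsum_eq_sum (s := Finset.Iic N) fun k hk =>
      rhsTerm_qpt_eq_zero hx K β fun h => hk (Finset.mem_Iic.2 h),
    ← sum_outerTerm_mul_sum_inverseTerm hq0 hq1 hx hxx ha N fun M =>
      K (qpt q M) * ∑ j ∈ Finset.Iic M, lhsTerm q b x β (qpt q M) j]
  refine Finset.sum_congr rfl fun k _ => ?_
  rw [rhsTerm, sum_middleTerm_mul_sum_innerTerm hq0 hq1 hx hxx hb]

/-! ### The identity theorem on a polydisc -/

/-- In each variable separately the points `q ^ N` accumulate at `0`; the variables are freed
from these points one at a time. -/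
theorem eqOn_polydisc_of_eq_qpt {n : ℕ} {q : ℂ} (hq0 : q ≠ 0) (hq1 : ‖q‖ < 1) {ε : Fin n → ℝ}
    (hε : ∀ r, 0 < ε r) {f g : (Fin n → ℂ) → ℂ} (hf : AnalyticOnNhd ℂ f (polydisc ε))
    (hg : AnalyticOnNhd ℂ g (polydisc ε)) (h : ∀ N, f (qpt q N) = g (qpt q N)) :
    Set.EqOn f g (polydisc ε) := by
  have key : ∀ S : Finset (Fin n), ∀ y ∈ polydisc ε, (∀ r ∉ S, ∃ i : ℕ, y r = q ^ i) →
      f y = g y := by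
    intro S
    induction S using Finset.induction_on with
    | empty =>
      intro y _ hy
      choose N hN using fun r => hy r (Finset.notMem_empty r)
      rw [show y = qpt q N from funext hN]
      exact h N
    | insert r S _ ih =>
      intro y hy hyS
      have hupd : AnalyticOnNhd ℂ (fun z => Function.update y r z) (Metric.ball 0 (ε r)) := by
        intro z _
        rw [analyticAt_pi_iff]
        intro s
        obtain rfl | hs := eq_or_ne s r
        · simp only [Function.update_self]
          exact analyticAt_id
        · simpa [Function.update_of_ne hs] using analyticAt_const
      have hmaps : Set.MapsTo (fun z => Function.update y r z) (Metric.ball 0 (ε r))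
          (polydisc ε) := by
        intro z hz s
        obtain rfl | hs := eq_or_ne s r
        · simpa using hz
        · simpa [Function.update_of_ne hs] using hy s
      have hlim : Filter.Tendsto (fun i : ℕ => q ^ i) Filter.atTop (nhdsWithin 0 {0}ᶜ) :=
        tendsto_nhdsWithin_iff.2 ⟨tendsto_pow_atTop_nhds_zero_of_norm_lt_one hq1,
          Filter.Eventually.of_forall fun i => pow_ne_zero i hq0⟩
      have hball : ∀ᶠ i : ℕ in Filter.atTop, q ^ i ∈ Metric.ball (0 : ℂ) (ε r) :=
        (tendsto_nhds_of_tendsto_nhdsWithin hlim).eventually (Metric.ball_mem_nhds 0 (hε r))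
      have hev : ∀ᶠ i : ℕ in Filter.atTop,
          f (Function.update y r (q ^ i)) = g (Function.update y r (q ^ i)) := by
        filter_upwards [hball] with i hi
        refine ih _ (hmaps hi) fun s hs => ?_
        obtain rfl | hsr := eq_or_ne s r
        · exact ⟨i, by simp⟩
        · rw [Function.update_of_ne hsr]
          exact hyS s (by simp [hsr, hs])
      have hE := (hf.comp hupd hmaps).eqOn_of_preconnected_of_frequently_eq (hg.comp hupd hmaps)
        (convex_ball (0 : ℂ) (ε r)).isPreconnected (Metric.mem_ball_self (hε r))
        (hlim.frequently hev.frequently)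
      have := hE (show y r ∈ Metric.ball 0 (ε r) by simpa using hy r)
      simpa using this
  exact fun y hy => key Finset.univ y hy fun r hr => absurd (Finset.mem_univ r) hr

end RootSeries

theorem mainTheorem6 {n : ℕ} (q a b : ℂ) (x : Fin n → ℂ)
    (hq0 : q ≠ 0) (hq1 : ‖q‖ < 1)
    -- the denominators that do not involve `y` are nonzero
    (hx : ∀ r, x r ≠ 0)
    (hxx : ∀ r s, r ≠ s → ∀ i : ℤ, x r / x s ≠ q ^ i)
    (ha : ∀ r, ∀ i : ℕ, 1 - a * x r * q ^ i ≠ 0)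
    (hb : ∀ r s, ∀ i : ℕ, 1 - b * x r * x s * q ^ i ≠ 0)
    (K : (Fin n → ℂ) → ℂ) (β : (Fin n → ℕ) → ℂ) :
    -- the terminating case `y = q ^ N`
    (∀ N : Fin n → ℕ,
      (∀ j, ¬ j ≤ N → RootSeries.lhsTerm q b x β (RootSeries.qpt q N) j = 0) ∧
      (∀ k, ¬ k ≤ N → RootSeries.rhsTerm q a b x K β (RootSeries.qpt q N) k = 0) ∧
      K (RootSeries.qpt q N) * ∑' j, RootSeries.lhsTerm q b x β (RootSeries.qpt q N) j =
        ∑' k, RootSeries.rhsTerm q a b x K β (RootSeries.qpt q N) k) ∧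
    -- the analytic case
    (∀ ε : Fin n → ℝ, (∀ r, 0 < ε r) →
      (∀ y ∈ RootSeries.polydisc ε, ∀ r, ∀ i : ℕ, 1 - a * q * x r * y r * q ^ i ≠ 0) →
      (∀ y ∈ RootSeries.polydisc ε, ∀ r s, ∀ i : ℕ,
        1 - b * q * x r * x s * y s * q ^ i ≠ 0) →
      (∀ y ∈ RootSeries.polydisc ε, Summable fun j => RootSeries.lhsTerm q b x β y j) →
      (∀ y ∈ RootSeries.polydisc ε, Summable fun k => RootSeries.rhsTerm q a b x K β y k) →
      AnalyticOnNhd ℂ (fun y => K y * ∑' j, RootSeries.lhsTerm q b x β y j)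
        (RootSeries.polydisc ε) →
      AnalyticOnNhd ℂ (fun y => ∑' k, RootSeries.rhsTerm q a b x K β y k)
        (RootSeries.polydisc ε) →
      ∀ y ∈ RootSeries.polydisc ε,
        K y * ∑' j, RootSeries.lhsTerm q b x β y j =
          ∑' k, RootSeries.rhsTerm q a b x K β y k) := by
  refine ⟨fun N => ⟨fun j hj => RootSeries.lhsTerm_qpt_eq_zero hx β hj,
    fun k hk => RootSeries.rhsTerm_qpt_eq_zero hx K β hk,
    RootSeries.mul_tsum_lhsTerm_qpt hq0 hq1 hx hxx ha hb K β N⟩,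
    fun ε hε _ _ _ _ hl hr => RootSeries.eqOn_polydisc_of_eq_qpt hq0 hq1 hε hl hr
      fun N => RootSeries.mul_tsum_lhsTerm_qpt hq0 hq1 hx hxx ha hb K β N⟩
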